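/- **Whitehead's cut vertex test.** Let $n \ge 0$, let $F_n = \langle s_1,\dots,s_n\rangle$ be the free group of rank $n$, and let $R_n$ be the rose with one vertex and oriented edges $e_1,\dots,e_n$, so that $F_n = \pi_1(R_n)$ with $s_i = [e_i]$. Let $H$ be a marked graph of rank $n$: a finite connected graph of rank $n$ (loop edges and multiple edges allowed) without vertices of valence $1$, together with a homotopy equivalence $\rho\colon R_n \to H$. A circuit in $H$ is a cyclically reduced closed edge path of positive length; it represents the conjugacy class of $g \in F_n = \pi_1(R_n)$ if it is freely homotopic to the image under $\rho$ of a loop representing $g$. Let $\gamma = (\gamma_1,\dots,\gamma_k)$ be a finite family of circuits in $H$ that represents a partial free basis of $F_n$: there are pairwise distinct elements $g_1,\dots,g_k$ contained in a common free basis of $F_n$ such that $\gamma_i$ represents the conjugacy class of $g_i$ for each $i$. For a vertex $v$ of $H$, the Whitehead graph $W_v\gamma$ is the following simple graph. Its vertices are the oriented edges $E$ with initial vertex $v$ such that $E$ or its reverse $\overline{E}$ occurs in some $\gamma_i$. Two such oriented edges $E \ne E'$ are joined by an edge if and only if $\overline{E}E'$ or $\overline{E'}E$ occurs as a pair of cyclically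 consecutive edges of some $\gamma_i$. A vertex $w$ of a connected simple graph $W$ is a cut vertex if there are vertices $u, u' \ne w$ of $W$ such that every edge path in $W$ from $u$ to $u'$ passes through $w$. Then $\gamma$ satisfies one of the following two conditions: - **Near visibility condition:** for each vertex $v$ of $H$, each component of $W_v\gamma$ is a single edge (with its two endpoints). - **Cut vertex condition:** for some vertex $v$ of $H$, some component of $W_v\gamma$ has a cut vertex. -/

import Mathlib

open scoped unitInterval ContinuousMap

/-- A graph (loop edges and multiple edges allowed), given by its vertices and its oriented edges.
`rev e` is the edge `e` with the opposite orientation, `src e` is the initial vertex of `e`.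
The associated 1-dimensional CW complex is `SerreGraph.Realization`. -/
structure SerreGraph where
  V : Type
  E : Type
  src : E → V
  rev : E → E
  rev_rev : ∀ e, rev (rev e) = e
  rev_ne : ∀ e, rev e ≠ e

namespace SerreGraph

variable (G : SerreGraph)

/-- The terminal vertex of an oriented edge. -/
def tgt (e : G.E) : G.V := G.src (G.rev e)

/-- Gluing relation of the geometric realization: each oriented edge `e` carries a copy of
`[0,1]`, its initial point is glued to the vertex `src e`, and the copies carried by `e` and by
`rev e` are identified by `t ↦ 1 - t`. -/
inductive Glue : G.V ⊕ (G.E × I) → G.V ⊕ (G.E × I) → Prop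
  | start (e : G.E) : Glue (Sum.inr (e, 0)) (Sum.inl (G.src e))
  | flip (e : G.E) (t : I) : Glue (Sum.inr (e, t)) (Sum.inr (G.rev e, unitInterval.symm t))

/-- The geometric realization of a graph, a 1-dimensional CW complex. -/
def Realization : Type := Quot G.Glue

/-- The 0-cell of a vertex. -/
def vertexPt (v : G.V) : G.Realization := Quot.mk _ (Sum.inl v)

/-- The characteristic map of an oriented edge. -/
def charMap (e : G.E) (t : I) : G.Realization := Quot.mk _ (Sum.inr (e, t))

/-- The CW topology: a set is open iff its preimage under every characteristic map is open. -/
instance : TopologicalSpace G.Realization :=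
  ⨆ e : G.E, TopologicalSpace.coinduced (G.charMap e) inferInstance

theorem continuous_charMap (e : G.E) : Continuous (G.charMap e) :=
  continuous_iff_coinduced_le.2
    (le_iSup (fun e : G.E => TopologicalSpace.coinduced (G.charMap e) inferInstance) e)

theorem charMap_zero (e : G.E) : G.charMap e 0 = G.vertexPt (G.src e) :=
  Quot.sound (Glue.start e)

theorem charMap_one (e : G.E) : G.charMap e 1 = G.vertexPt (G.tgt e) := by
  have h : G.charMap e 1 = G.charMap (G.rev e) (unitInterval.symm 1) :=
    Quot.sound (Glue.flip e 1)
  rw [h, unitInterval.symm_one, charMap_zero]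
  rfl

/-- The continuous path that crosses an oriented edge once. -/
def edgePath (e : G.E) : Path (G.vertexPt (G.src e)) (G.vertexPt (G.tgt e)) where
  toFun := G.charMap e
  continuous_toFun := G.continuous_charMap e
  source' := G.charMap_zero e
  target' := G.charMap_one e

/-- `G.IsEdgePath u l w`: the list `l` of oriented edges is an edge path from `u` to `w`. -/
def IsEdgePath : G.V → List G.E → G.V → Prop
  | u, [], w => u = w
  | u, e :: l, w => G.src e = u ∧ IsEdgePath (G.tgt e) l w

/-- The continuous path in the realization that runs through the edges of an edge path. -/
noncomputable def realizePath : (u : G.V) → (l : List G.E) → (w : G.V) → G.IsEdgePath u l w →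
    Path (G.vertexPt u) (G.vertexPt w)
  | u, [], _, h => (Path.refl (G.vertexPt u)).cast rfl (congrArg G.vertexPt (Eq.symm h))
  | _, e :: l, w, h =>
      ((G.edgePath e).trans (realizePath (G.tgt e) l w h.2)).cast
        (congrArg G.vertexPt (Eq.symm h.1)) rfl

/-- The set `T_v G` of directions at `v`: the oriented edges with initial vertex `v`. -/
def Direction (v : G.V) : Type := {e : G.E // G.src e = v}

/-- A finite connected graph of rank `n` (that is, `1 - |V| + |edges| = n`, where each edge has
two orientations) without vertices of valence one. -/
structure IsCoreOfRank (n : ℕ) : Prop where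
  finite_V : Finite G.V
  finite_E : Finite G.E
  nonempty : Nonempty G.V
  connected : ∀ u w : G.V, ∃ l, G.IsEdgePath u l w
  rank_eq : 2 * Nat.card G.V + 2 * n = Nat.card G.E + 2
  core : ∀ v, Nat.card (G.Direction v) ≠ 1

/-- A circuit, given by a cyclically reduced closed edge path. Two oriented edges `e`, `e'` are
cyclically consecutive in the closed edge path `l` iff `[e, e']` is an infix of `l ++ l`. -/
structure Circuit where
  base : G.V
  edges : List G.E
  edges_ne_nil : edges ≠ []
  closed : G.IsEdgePath base edges base
  reduced : ∀ e e', [e, e'] <:+: edges ++ edges → e' ≠ G.rev e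

/-- The loop in the realization that runs once around a circuit. -/
noncomputable def Circuit.loop {G : SerreGraph} (c : G.Circuit) :
    Path (G.vertexPt c.base) (G.vertexPt c.base) :=
  G.realizePath c.base c.edges c.base c.closed

/-- The base rose of rank `n`: one vertex, and for each `i : Fin n` an edge `e_i` with its two
orientations `(i, true) = e_i` and `(i, false)`, the reverse of `e_i`. -/
def rose (n : ℕ) : SerreGraph where
  V := Unit
  E := Fin n × Bool
  src _ := ()
  rev e := (e.1, !e.2)
  rev_rev := by simp
  rev_ne := by simp [Prod.ext_iff]

theorem rose_isEdgePath (n : ℕ) (l : List (rose n).E) : (rose n).IsEdgePath () l () := by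
  induction l with
  | nil => rfl
  | cons e l ih => exact ⟨rfl, ih⟩

/-- The loop in the base rose that represents an element of the free group, under the standard
identification of `F_n` with the fundamental group of the rose which sends `s_i` to the class
of `e_i`: the reduced word of `g` is spelled out from left to right. -/
noncomputable def wordLoop {n : ℕ} (g : FreeGroup (Fin n)) :
    Path ((rose n).vertexPt ()) ((rose n).vertexPt ()) :=
  (rose n).realizePath () g.toWord () (rose_isEdgePath n g.toWord)

/-- The Whitehead graph at `v` of a family of circuits, a subgraph of the complete graph on the
directions at `v`. A direction is a vertex if its edge is crossed by the family in one of the two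
orientations. A turn `{d, d'}` is an edge if the family or its reversal contains the subpath
`rev d, d'`; equivalently, the family contains `rev d, d'` or `rev d', d`. -/
def whiteheadGraph {ι : Type*} (γ : ι → G.Circuit) (v : G.V) :
    (⊤ : SimpleGraph (G.Direction v)).Subgraph where
  verts := {d | ∃ i, d.1 ∈ (γ i).edges ∨ G.rev d.1 ∈ (γ i).edges}
  Adj d d' := d ≠ d' ∧ ∃ i, [G.rev d.1, d'.1] <:+: (γ i).edges ++ (γ i).edges ∨
    [G.rev d'.1, d.1] <:+: (γ i).edges ++ (γ i).edges
  adj_sub h := h.1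
  edge_vert := by
    rintro d d' ⟨-, i, h | h⟩
    · exact ⟨i, Or.inr (by simpa using h.subset (List.mem_cons_self ..))⟩
    · exact ⟨i, Or.inl (by simpa using h.subset (List.mem_cons_of_mem _ (List.mem_cons_self ..)))⟩
  symm := ⟨fun _ _ ⟨h, i, hi⟩ => ⟨h.symm, i, hi.symm⟩⟩

end SerreGraph

/-- A simple graph consists of a single edge and its two endpoints. -/
def IsSingleEdge {α : Type*} (W : SimpleGraph α) : Prop :=
  ∃ a b, W.Adj a b ∧ ∀ c, c = a ∨ c = b

/-- `w` is a cut vertex of the (connected) graph `W`: there are two vertices other than `w` such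
that every edge path between them passes through `w`. -/
def IsCutVertex {α : Type*} (W : SimpleGraph α) (w : α) : Prop :=
  ∃ u v, u ≠ w ∧ v ≠ w ∧ ∀ p : W.Walk u v, w ∈ p.support

/-- Every component of every Whitehead graph is a single edge. -/
def NearVisibility {G : SerreGraph} {ι : Type*} (γ : ι → G.Circuit) : Prop :=
  ∀ v : G.V, ∀ C : (G.whiteheadGraph γ v).coe.ConnectedComponent, IsSingleEdge C.toSimpleGraph

/-- Some component of some Whitehead graph has a cut vertex. -/
def CutVertexCondition {G : SerreGraph} {ι : Type*} (γ : ι → G.Circuit) : Prop :=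
  ∃ v : G.V, ∃ C : (G.whiteheadGraph γ v).coe.ConnectedComponent, ∃ w, IsCutVertex C.toSimpleGraph w

/-- Free homotopy of loops, that is, homotopy of the corresponding maps of the circle. -/
def FreelyHomotopic {X : Type*} [TopologicalSpace X] {x y : X} (p : Path x x) (q : Path y y) :
    Prop :=
  ∃ H : C(I × I, X), (∀ s, H (0, s) = p s) ∧ (∀ s, H (1, s) = q s) ∧ ∀ t, H (t, 0) = H (t, 1)

/-- A tuple of pairwise distinct group elements that is contained in a free basis. -/
def IsPartialFreeBasis {F : Type} [Group F] {ι : Type*} (g : ι → F) : Prop :=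
  Function.Injective g ∧
    ∃ (κ : Type) (b : FreeGroupBasis κ F), Set.range g ⊆ Set.range b

/-- A marked graph: a rank `n` core graph with a homotopy equivalence from the base rose. -/
structure MarkedGraph (n : ℕ) where
  graph : SerreGraph
  isCore : graph.IsCoreOfRank n
  marking : (SerreGraph.rose n).Realization ≃ₕ graph.Realization

namespace MarkedGraph

variable {n : ℕ} (H : MarkedGraph n)

/-- The circuit `c` represents the conjugacy class of `g`: the image under the marking of the
loop of `g` in the base rose is freely homotopic to `c`. -/
def Represents (c : H.graph.Circuit) (g : FreeGroup (Fin n)) : Prop :=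
  FreelyHomotopic ((SerreGraph.wordLoop g).map H.marking.toFun.continuous) c.loop

/-- A family of circuits represents a partial free basis of `F_n`: there are pairwise distinct
elements that belong to a common free basis and whose conjugacy classes are represented by the
respective circuits. -/
def RepresentsPartialFreeBasis {ι : Type*} (γ : ι → H.graph.Circuit) : Prop :=
  ∃ g : ι → FreeGroup (Fin n), IsPartialFreeBasis g ∧ ∀ i, H.Represents (γ i) (g i)

end MarkedGraph

/-! The proof is by Stallings folding. Complete the partial basis to the given free basis and write
each basis element as a lollipop in `H`: a stem from a base vertex `o`, a closed path, and the stem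
traversed backwards, where the closed path is `γ i` whenever the element belongs to the partial
basis. The wedge `Γ` of these lollipops, subdivided, maps to `H` by a morphism of graphs that is an
isomorphism on fundamental groups, precisely because the lollipops form a basis. In `Γ` the circuits
are embedded circles, so that exactly one turn is taken at each direction they use, and all
Whitehead graphs consist of disjoint edges.

Now fold `Γ` until its map to `H` is an immersion. An immersion that is surjective on fundamental
groups is injective on edges and changes no Whitehead graph. A fold of `e₁` with `e₂` is an
isomorphism on fundamental groups only if the two edges end at different vertices
(`IsUnfolding.tgt_ne`). If the circuits cross both edges, the fold glues a Whitehead graph at one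
endpoint to one at the other endpoint along a single vertex, which becomes a cut vertex
(`IsImage.hasCutVertex_of_glue`). If they do not cross both, the fold is injective on the directions
in use and the Whitehead graphs keep their shape. Hence "disjoint edges or a cut vertex" survives
every fold (`good_fold`, `good_map`). All vertices are treated at once by taking the union of the
Whitehead graphs, `turnGraph`, on the set of oriented edges.

Fundamental groups enter through `pathClass`, which sends an edge path to the free group on the
oriented edges and is a complete invariant of homotopy relative to endpoints. This rests on two
topological facts about the realization: each path between vertices is homotopic to an edge path
(`exists_isEdgeClass`), and homotopic edge paths have the same class (`IsEdgeClass.pathClass_eq`, by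
monodromy in an explicit covering). They turn the marking into an injective homomorphism onto the
classes of loops at `o`, and free homotopy into conjugacy (`exists_markingHom`);
`turnGraph_good_of_basis` is the combinatorial core. -/

namespace SerreGraph

/-! ### Edge paths and their classes -/

section Paths

variable {G : SerreGraph}

theorem tgt_rev (e : G.E) : G.tgt (G.rev e) = G.src e := by rw [tgt, rev_rev]

theorem src_rev (e : G.E) : G.src (G.rev e) = G.tgt e := rfl

theorem rev_injective : Function.Injective G.rev :=
  Function.LeftInverse.injective G.rev_rev

theorem IsEdgePath.append {u v w : G.V} {l l' : List G.E} (h : G.IsEdgePath u l v)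
    (h' : G.IsEdgePath v l' w) : G.IsEdgePath u (l ++ l') w := by
  induction l generalizing u with
  | nil => cases h; exact h'
  | cons e l ih => exact ⟨h.1, ih h.2⟩

theorem isEdgePath_append {u w : G.V} {l l' : List G.E} :
    G.IsEdgePath u (l ++ l') w ↔ ∃ v, G.IsEdgePath u l v ∧ G.IsEdgePath v l' w := by
  refine ⟨fun h => ?_, fun ⟨v, h, h'⟩ => h.append h'⟩
  induction l generalizing u with
  | nil => exact ⟨u, rfl, h⟩
  | cons e l ih =>
    obtain ⟨v, hv, hv'⟩ := ih h.2
    exact ⟨v, ⟨h.1, hv⟩, hv'⟩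

/-- The edge path traversed backwards. -/
def reversePath (l : List G.E) : List G.E := (l.map G.rev).reverse

theorem reversePath_cons (e : G.E) (l : List G.E) :
    reversePath (e :: l) = reversePath l ++ [G.rev e] := by
  simp [reversePath]

theorem IsEdgePath.reverse {u w : G.V} {l : List G.E} (h : G.IsEdgePath u l w) :
    G.IsEdgePath w (reversePath l) u := by
  induction l generalizing u with
  | nil => exact h.symm
  | cons e l ih =>
    rw [reversePath_cons]
    refine (ih h.2).append ?_
    exact ⟨rfl, (tgt_rev e).trans h.1⟩

/-- In a closed edge path, cyclically consecutive edges are composable. -/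
theorem IsEdgePath.src_eq_tgt_of_infix {u w : G.V} {l : List G.E} (h : G.IsEdgePath u l w)
    {e e' : G.E} (hi : [e, e'] <:+: l) : G.src e' = G.tgt e := by
  obtain ⟨s, t, rfl⟩ := hi
  obtain ⟨v, hv, -⟩ := isEdgePath_append.1 h
  obtain ⟨v', -, hv'⟩ := isEdgePath_append.1 hv
  exact hv'.2.1

variable (G) in
/-- The class of an oriented edge in the free group on the oriented edges. It is inverted by
reversing the orientation, and a reduced edge path becomes a reduced word. -/
def edgeClass (e : G.E) : FreeGroup G.E := FreeGroup.of e * (FreeGroup.of (G.rev e))⁻¹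

variable (G) in
/-- The class of an edge path: two edge paths with the same endpoints have the same class iff
they are homotopic. -/
def pathClass (l : List G.E) : FreeGroup G.E := (l.map G.edgeClass).prod

theorem edgeClass_rev (e : G.E) : G.edgeClass (G.rev e) = (G.edgeClass e)⁻¹ := by
  simp [edgeClass, rev_rev]

@[simp] theorem pathClass_nil : G.pathClass [] = 1 := rfl

@[simp] theorem pathClass_cons (e : G.E) (l : List G.E) :
    G.pathClass (e :: l) = G.edgeClass e * G.pathClass l := by
  simp [pathClass]

@[simp] theorem pathClass_append (l l' : List G.E) :
    G.pathClass (l ++ l') = G.pathClass l * G.pathClass l' := by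
  simp [pathClass]

@[simp] theorem pathClass_reversePath (l : List G.E) :
    G.pathClass (reversePath l) = (G.pathClass l)⁻¹ := by
  induction l with
  | nil => simp [reversePath]
  | cons e l ih => simp [reversePath_cons, ih, edgeClass_rev]

variable (G) in
/-- An edge path is reduced if it has no backtracking. -/
def IsReducedPath (l : List G.E) : Prop := l.IsChain fun e e' => e' ≠ G.rev e

/-- The word on oriented edges that spells the class of an edge path. -/
def spell (l : List G.E) : List (G.E × Bool) := l.flatMap fun e => [(e, true), (G.rev e, false)]

theorem mk_spell (l : List G.E) : FreeGroup.mk (spell l) = G.pathClass l := by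
  induction l with
  | nil => rfl
  | cons e l ih =>
    rw [pathClass_cons, ← ih, edgeClass, FreeGroup.of, FreeGroup.of, FreeGroup.inv_mk,
      FreeGroup.mul_mk, FreeGroup.mul_mk]
    rfl

theorem spell_injective : Function.Injective (spell : List G.E → List (G.E × Bool)) := by
  intro l
  induction l with
  | nil =>
    intro l' h
    cases l' with
    | nil => rfl
    | cons e l' => simp [spell] at h
  | cons e l ih =>
    intro l' h
    cases l' with
    | nil => simp [spell] at h
    | cons e' l' =>
      simp only [spell, List.flatMap_cons, List.cons_append, List.nil_append, List.cons.injEq,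
        Prod.mk.injEq, and_true] at h
      rw [h.1, ih h.2.2]

/-- The two letters of one edge do not cancel because `rev e ≠ e`. The second letter of `e` and the
first letter of its successor `e'` cancel only if `e' = rev e`, which is backtracking. -/
theorem isReduced_spell {l : List G.E} (h : G.IsReducedPath l) :
    FreeGroup.IsReduced (spell l) := by
  induction l with
  | nil => exact FreeGroup.IsReduced.nil
  | cons e l ih =>
    cases l with
    | nil =>
      refine FreeGroup.isReduced_cons_cons.2 ⟨fun he => absurd he.symm (G.rev_ne e), ?_⟩
      exact FreeGroup.IsReduced.singleton
    | cons e' l =>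
      have h' := List.isChain_cons_cons.1 h
      refine FreeGroup.isReduced_cons_cons.2 ⟨fun he => absurd he.symm (G.rev_ne e), ?_⟩
      refine FreeGroup.isReduced_cons_cons.2 ⟨fun he => absurd he.symm h'.1, ih h'.2⟩

/-- Uniqueness of reduced words in a free group becomes uniqueness of reduced edge paths in their
class. -/
theorem IsReducedPath.eq_of_pathClass_eq {l l' : List G.E} (h : G.IsReducedPath l)
    (h' : G.IsReducedPath l') (hc : G.pathClass l = G.pathClass l') : l = l' := by
  classical
  rw [← mk_spell, ← mk_spell] at hc
  have := congrArg FreeGroup.toWord hc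
  rw [FreeGroup.toWord_mk, FreeGroup.toWord_mk, (isReduced_spell h).reduce_eq,
    (isReduced_spell h').reduce_eq] at this
  exact spell_injective this

/-- The induction principle behind the reduction of edge paths: a relation on edge paths which is
compatible with prepending an edge and with cancellation relates each path to a reduced one. -/
theorem exists_isReducedPath (R : G.V → G.V → List G.E → List G.E → Prop)
    (nil : ∀ u, R u u [] [])
    (cons : ∀ e w l l', G.IsEdgePath (G.tgt e) l w → G.IsEdgePath (G.tgt e) l' w →
      R (G.tgt e) w l l' → R (G.src e) w (e :: l) (e :: l'))
    (cancel : ∀ e w l l', G.IsEdgePath (G.src e) l' w →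
      R (G.src e) w l (e :: G.rev e :: l') → R (G.src e) w l l')
    {u w : G.V} {l : List G.E} (h : G.IsEdgePath u l w) :
    ∃ l', G.IsEdgePath u l' w ∧ G.IsReducedPath l' ∧ R u w l l' := by
  induction l generalizing u with
  | nil => cases h; exact ⟨[], rfl, List.IsChain.nil, nil _⟩
  | cons e l ih =>
    obtain ⟨rfl, h⟩ := h
    obtain ⟨l', hp, hr, hR⟩ := ih h
    have hc := cons e w l l' h hp hR
    cases l' with
    | nil => exact ⟨[e], ⟨rfl, hp⟩, List.isChain_singleton _, hc⟩
    | cons e' l' =>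
      by_cases he : e' = G.rev e
      · subst he
        have hp' : G.IsEdgePath (G.src e) l' w := by rw [← tgt_rev e]; exact hp.2
        exact ⟨l', hp', hr.tail, cancel e w _ l' hp' hc⟩
      · exact ⟨e :: e' :: l', ⟨rfl, hp⟩, List.isChain_cons_cons.2 ⟨he, hr⟩, hc⟩

theorem exists_isReducedPath_pathClass {u w : G.V} {l : List G.E} (h : G.IsEdgePath u l w) :
    ∃ l', G.IsEdgePath u l' w ∧ G.IsReducedPath l' ∧ G.pathClass l = G.pathClass l' :=
  exists_isReducedPath (fun _ _ l l' => G.pathClass l = G.pathClass l') (fun _ => rfl)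
    (fun e _ l l' _ _ h => by rw [pathClass_cons, pathClass_cons, h])
    (fun e _ l l' _ h => by rw [h]; simp [edgeClass_rev]) h

end Paths

/-! ### Morphisms of graphs -/

/-- A morphism of graphs sends vertices to vertices and oriented edges to oriented edges. -/
structure Hom (Γ H : SerreGraph) where
  vert : Γ.V → H.V
  edge : Γ.E → H.E
  src_edge : ∀ e, H.src (edge e) = vert (Γ.src e)
  rev_edge : ∀ e, edge (Γ.rev e) = H.rev (edge e)

namespace Hom

variable {Γ H : SerreGraph} (f : Γ.Hom H)

theorem tgt_edge (e : Γ.E) : H.tgt (f.edge e) = f.vert (Γ.tgt e) := by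
  rw [tgt, ← f.rev_edge, f.src_edge]; rfl

theorem isEdgePath {u w : Γ.V} {l : List Γ.E} (h : Γ.IsEdgePath u l w) :
    H.IsEdgePath (f.vert u) (l.map f.edge) (f.vert w) := by
  induction l generalizing u with
  | nil => exact congrArg f.vert h
  | cons e l ih =>
    refine ⟨by rw [f.src_edge, h.1], ?_⟩
    rw [tgt_edge]
    exact ih h.2

theorem map_edgeClass (e : Γ.E) :
    FreeGroup.map f.edge (Γ.edgeClass e) = H.edgeClass (f.edge e) := by
  simp [edgeClass, f.rev_edge]

theorem map_pathClass (l : List Γ.E) :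
    FreeGroup.map f.edge (Γ.pathClass l) = H.pathClass (l.map f.edge) := by
  induction l with
  | nil => simp
  | cons e l ih => simp [ih, map_edgeClass]

/-- A morphism is an immersion if it is injective on the edges issuing from each vertex. -/
def IsImmersion : Prop := ∀ e e', Γ.src e = Γ.src e' → f.edge e = f.edge e' → e = e'

variable {f}

/-- The successor `e'` of `e` and the edge `rev e` issue from the same vertex, so backtracking in
the image would already be backtracking upstairs. -/
theorem IsImmersion.isReducedPath (hf : f.IsImmersion) {u w : Γ.V} {l : List Γ.E}
    (hp : Γ.IsEdgePath u l w) (h : Γ.IsReducedPath l) : H.IsReducedPath (l.map f.edge) := by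
  induction l generalizing u with
  | nil => exact List.IsChain.nil
  | cons e l ih =>
    cases l with
    | nil => exact List.isChain_singleton _
    | cons e' l =>
      have h' := List.isChain_cons_cons.1 h
      refine List.isChain_cons_cons.2 ⟨fun he => h'.1 (hf _ _ ?_ ?_), ih hp.2 h'.2⟩
      · rw [hp.2.1]; rfl
      · rw [he, f.rev_edge]

theorem IsImmersion.eq_of_map_eq (hf : f.IsImmersion) {u w w' : Γ.V} {l l' : List Γ.E}
    (hp : Γ.IsEdgePath u l w) (hp' : Γ.IsEdgePath u l' w')
    (h : l.map f.edge = l'.map f.edge) : w = w' := by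
  induction l generalizing u l' with
  | nil =>
    cases l' with
    | nil => exact hp.symm.trans hp'
    | cons e' l' => simp at h
  | cons e l ih =>
    cases l' with
    | nil => simp at h
    | cons e' l' =>
      simp only [List.map_cons, List.cons.injEq] at h
      have := hf e e' (hp.1.trans hp'.1.symm) h.1
      subst this
      exact ih hp.2 hp'.2 h.2

/-- An immersion that is surjective on fundamental groups is injective. -/
theorem IsImmersion.edge_injective (hf : f.IsImmersion) {b : Γ.V}
    (hconn : ∀ e, ∃ l, Γ.IsEdgePath b l (Γ.src e))
    (hsurj : ∀ l, H.IsEdgePath (f.vert b) l (f.vert b) →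
      ∃ l', Γ.IsEdgePath b l' b ∧ H.pathClass (l'.map f.edge) = H.pathClass l) :
    Function.Injective f.edge := by
  intro e e' he
  obtain ⟨m, hm⟩ := hconn e
  obtain ⟨m', hm'⟩ := hconn e'
  have hv : f.vert (Γ.src e) = f.vert (Γ.src e') := by rw [← f.src_edge, he, f.src_edge]
  have hH := f.isEdgePath hm'
  rw [← hv] at hH
  -- The sources of `e` and `e'` have the same image, so the image of `m` followed by the reversed
  -- image of `m'` is a loop; `l` is a loop at `b` with this class. Then `l ++ m'` and `m` have
  -- images of equal class. Their reduced forms therefore have equal images and, by unique lifting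
  -- from `b`, the same endpoint.
  obtain ⟨l, hl, hc⟩ := hsurj _ ((f.isEdgePath hm).append hH.reverse)
  obtain ⟨q, hq, hqr, hqc⟩ := exists_isReducedPath_pathClass (hl.append hm')
  obtain ⟨q', hq', hqr', hqc'⟩ := exists_isReducedPath_pathClass hm
  refine hf e e' ?_ he
  refine hf.eq_of_map_eq hq' hq ?_
  refine (hf.isReducedPath hq' hqr').eq_of_pathClass_eq (hf.isReducedPath hq hqr) ?_
  rw [← map_pathClass, ← map_pathClass, ← hqc', ← hqc, map_pathClass, map_pathClass,
    List.map_append, pathClass_append, hc]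
  simp

end Hom

end SerreGraph

/-! ### Graphs of disjoint edges and cut vertices -/

namespace SimpleGraph

variable {A B V : Type*}

/-- Each vertex has at most one neighbour. -/
def HasDisjointEdges (T : SimpleGraph A) : Prop := ∀ a b c, T.Adj a b → T.Adj a c → b = c

/-- Some component has a cut vertex. -/
def HasCutVertex (T : SimpleGraph A) : Prop :=
  ∃ w u v, u ≠ w ∧ v ≠ w ∧ T.Reachable u v ∧ ∀ p : T.Walk u v, w ∈ p.support

theorem mem_support_of_mem_walk {T : SimpleGraph A} {u v w : A} (p : T.Walk u v) (hu : u ≠ w)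
    (hw : w ∈ p.support) : u ∈ T.support ∧ w ∈ T.support := by
  induction p with
  | nil => simp at hw; exact absurd hw.symm hu
  | @cons a b c hab p ih =>
    refine ⟨⟨b, hab⟩, ?_⟩
    rw [Walk.support_cons, List.mem_cons] at hw
    rcases hw with rfl | hw
    · exact absurd rfl hu
    · by_cases hb : b = w
      · exact hb ▸ ⟨a, hab.symm⟩
      · exact (ih hb hw).2

/-- `T'` is the image of `T` under the map `φ` of the vertex sets. -/
def IsImage (φ : A → B) (T : SimpleGraph A) (T' : SimpleGraph B) : Prop :=
  ∀ x y, T'.Adj x y ↔ ∃ a b, T.Adj a b ∧ φ a = x ∧ φ b = y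

variable {T : SimpleGraph A} {T' : SimpleGraph B} {φ : A → B}

/-- The map onto the image graph. -/
def IsImage.hom (h : IsImage φ T T') : T →g T' where
  toFun := φ
  map_rel' {a b} hab := (h _ _).2 ⟨a, b, hab, rfl, rfl⟩

theorem IsImage.hasDisjointEdges (h : IsImage φ T T') (hφ : Set.InjOn φ T.support)
    (hT : T.HasDisjointEdges) : T'.HasDisjointEdges := by
  intro x y z hy hz
  obtain ⟨a, b, hab, rfl, rfl⟩ := (h _ _).1 hy
  obtain ⟨a', c, hac, ha, rfl⟩ := (h _ _).1 hz
  rw [hφ ⟨c, hac⟩ ⟨b, hab⟩ ha] at hac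
  rw [hT a b c hab hac]

/-- Consecutive edges of a walk in the image lift to edges whose common endpoint is unique, by
injectivity on the support. Isolated vertices of `T` may be identified freely. -/
theorem IsImage.exists_walk (h : IsImage φ T T') (hφ : Set.InjOn φ T.support) {x y : B}
    (p : T'.Walk x y) (a : A) (ha : a ∈ T.support) (hx : φ a = x) :
    ∃ b, b ∈ T.support ∧ φ b = y ∧ ∃ q : T.Walk a b, q.support.map φ = p.support := by
  induction p generalizing a with
  | nil => exact ⟨a, ha, hx, Walk.nil, by simp [hx]⟩
  | @cons x z y hxz p ih =>
    obtain ⟨a', b, hab, ha', hb⟩ := (h _ _).1 hxz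
    rw [hφ ⟨b, hab⟩ ha (ha'.trans hx.symm)] at hab
    obtain ⟨c, hc, hc', q, hq⟩ := ih b ⟨a, hab.symm⟩ hb
    exact ⟨c, hc, hc', Walk.cons hab q, by simp [hq, hx]⟩

theorem IsImage.hasCutVertex (h : IsImage φ T T') (hφ : Set.InjOn φ T.support)
    (hT : T.HasCutVertex) : T'.HasCutVertex := by
  obtain ⟨w, u, v, hu, hv, ⟨p⟩, hw⟩ := hT
  obtain ⟨hus, hws⟩ := mem_support_of_mem_walk p hu (hw p)
  have hvs := (mem_support_of_mem_walk p.reverse hv (by simpa using hw p)).1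
  refine ⟨φ w, φ u, φ v, fun hh => hu (hφ hus hws hh), fun hh => hv (hφ hvs hws hh),
    ⟨p.map h.hom⟩, fun p' => ?_⟩
  obtain ⟨b, hb, hbv, q, hq⟩ := h.exists_walk hφ p' u hus rfl
  obtain rfl := hφ hb hvs hbv
  rw [← hq]
  exact List.mem_map_of_mem (hw q)

/-- If `φ` glues two vertices that lie in different pieces of `T`, and otherwise glues only
vertices in the same piece, then the resulting vertex is a cut vertex. -/
theorem IsImage.hasCutVertex_of_glue (h : IsImage φ T T') (s : A → V)
    (hs : ∀ a b, T.Adj a b → s a = s b) {x y : A} (hxy : φ x = φ y) (hne : s x ≠ s y)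
    (hglue : ∀ a b, φ a = φ b → φ a ≠ φ x → s a = s b) (hx : x ∈ T.support)
    (hy : y ∈ T.support) : T'.HasCutVertex := by
  obtain ⟨u, hu⟩ := hx
  obtain ⟨v, hv⟩ := hy
  have hu' : T'.Adj (φ x) (φ u) := h.hom.map_adj hu
  have hv' : T'.Adj (φ x) (φ v) := hxy ▸ h.hom.map_adj hv
  refine ⟨φ x, φ u, φ v, hu'.ne', hv'.ne', ⟨Walk.cons hu'.symm (Walk.cons hv' Walk.nil)⟩,
    fun p => by_contra fun hp => hne ?_⟩
  -- A walk that avoids the glued vertex never changes piece: its edges lift to edges of `T`, and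
  -- all identifications at the remaining vertices respect `s`.
  have key : ∀ {z z' : B} (p : T'.Walk z z'), φ x ∉ p.support → ∀ a b, φ a = z → φ b = z' →
      s a = s b := by
    intro z z' p
    induction p with
    | nil =>
      intro hz a b ha hb
      exact hglue a b (ha.trans hb.symm) fun hh => hz (by simp [← ha, hh])
    | @cons z t z' hzt p ih =>
      intro hz a b ha hb
      rw [Walk.support_cons, List.mem_cons, not_or] at hz
      obtain ⟨a', t', hat, ha', ht'⟩ := (h _ _).1 hzt
      rw [hglue a a' (ha.trans ha'.symm) fun hh => hz.1 (hh.symm.trans ha), hs _ _ hat]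
      exact ih hz.2 t' b ht' hb
  rw [hs _ _ hu, hs _ _ hv]
  exact key p hp u v rfl rfl

end SimpleGraph

namespace SerreGraph

/-! ### Turn graphs -/

section Turns

variable {ι : Type*}

theorem infix_map_pair {A B : Type*} {f : A → B} {l : List A} {x y : B} :
    [x, y] <:+: l.map f ↔ ∃ a b, [a, b] <:+: l ∧ f a = x ∧ f b = y := by
  constructor
  · intro h
    obtain ⟨l', hl', h'⟩ := List.infix_map_iff.1 h
    rcases l' with _ | ⟨a, _ | ⟨b, _ | ⟨c, l'⟩⟩⟩ <;> simp at h'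
    exact ⟨a, b, hl', h'.1.symm, h'.2.symm⟩
  · rintro ⟨a, b, h, rfl, rfl⟩
    exact h.map f

/-- The union of the Whitehead graphs of a family of closed edge paths, as a simple graph on the
set of all oriented edges. -/
def turnGraph (G : SerreGraph) (c : ι → List G.E) : SimpleGraph G.E where
  Adj d d' := d ≠ d' ∧ ∃ i, [G.rev d, d'] <:+: c i ++ c i ∨ [G.rev d', d] <:+: c i ++ c i
  symm := ⟨fun _ _ ⟨h, i, hi⟩ => ⟨h.symm, i, hi.symm⟩⟩
  loopless := ⟨fun _ h => h.1 rfl⟩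

/-- A family of closed edge paths, as cyclic sequences of edges: cyclically consecutive edges are
composable. -/
def IsCyclicFamily (G : SerreGraph) (c : ι → List G.E) : Prop :=
  ∀ i e e', [e, e'] <:+: c i ++ c i → G.src e' = G.tgt e

/-- Cyclically consecutive edges are never inverse to each other. -/
def IsReducedFamily (G : SerreGraph) (c : ι → List G.E) : Prop :=
  ∀ i e e', [e, e'] <:+: c i ++ c i → e' ≠ G.rev e

variable {Γ H : SerreGraph}

theorem IsCyclicFamily.src_eq {c : ι → List Γ.E} (hc : Γ.IsCyclicFamily c) {d d' : Γ.E}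
    (h : (Γ.turnGraph c).Adj d d') : Γ.src d = Γ.src d' := by
  obtain ⟨-, i, h | h⟩ := h
  · rw [hc i _ _ h, tgt_rev]
  · rw [hc i _ _ h, tgt_rev]

theorem IsCyclicFamily.map (f : Γ.Hom H) {c : ι → List Γ.E} (hc : Γ.IsCyclicFamily c) :
    H.IsCyclicFamily fun i => (c i).map f.edge := by
  intro i e e' h
  dsimp only at h
  rw [← List.map_append] at h
  obtain ⟨a, b, hab, rfl, rfl⟩ := infix_map_pair.1 h
  rw [f.src_edge, hc i a b hab, f.tgt_edge]

theorem IsReducedFamily.of_map (f : Γ.Hom H) {c : ι → List Γ.E}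
    (hc : H.IsReducedFamily fun i => (c i).map f.edge) : Γ.IsReducedFamily c := by
  intro i e e' h he
  refine hc i (f.edge e) (f.edge e') ?_ (by rw [he, f.rev_edge])
  dsimp only
  rw [← List.map_append]
  exact h.map f.edge

/-- A turn could be lost only if its two directions had the same image, but then the image path
would backtrack there. Reducedness in the target excludes this. -/
theorem isImage_turnGraph (f : Γ.Hom H) {c : ι → List Γ.E}
    (hc : H.IsReducedFamily fun i => (c i).map f.edge) :
    SimpleGraph.IsImage f.edge (Γ.turnGraph c) (H.turnGraph fun i => (c i).map f.edge) := by
  have key : ∀ i x y, [H.rev x, y] <:+: (c i).map f.edge ++ (c i).map f.edge →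
      ∃ a b, [Γ.rev a, b] <:+: c i ++ c i ∧ f.edge a = x ∧ f.edge b = y := by
    intro i x y h
    rw [← List.map_append] at h
    obtain ⟨a, b, hab, ha, rfl⟩ := infix_map_pair.1 h
    refine ⟨Γ.rev a, b, by rwa [rev_rev], ?_, rfl⟩
    rw [f.rev_edge, ha, rev_rev]
  have key' : ∀ i a b, [Γ.rev a, b] <:+: c i ++ c i →
      [H.rev (f.edge a), f.edge b] <:+: (c i).map f.edge ++ (c i).map f.edge := by
    intro i a b h
    rw [← List.map_append, ← f.rev_edge]
    exact h.map f.edge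
  intro x y
  constructor
  · rintro ⟨hxy, i, h | h⟩
    · obtain ⟨a, b, hab, rfl, rfl⟩ := key i _ _ h
      exact ⟨a, b, ⟨fun hh => hxy (by rw [hh]), i, Or.inl hab⟩, rfl, rfl⟩
    · obtain ⟨b, a, hab, rfl, rfl⟩ := key i _ _ h
      exact ⟨a, b, ⟨fun hh => hxy (by rw [hh]), i, Or.inr hab⟩, rfl, rfl⟩
  · rintro ⟨a, b, ⟨-, i, h | h⟩, rfl, rfl⟩
    · have := key' i _ _ h
      refine ⟨fun hh => hc i _ _ this ?_, i, Or.inl this⟩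
      rw [rev_rev, hh]
    · have := key' i _ _ h
      refine ⟨fun hh => hc i _ _ this ?_, i, Or.inr this⟩
      rw [rev_rev, hh]

theorem mem_support_turnGraph {c : ι → List Γ.E} {d : Γ.E} :
    d ∈ (Γ.turnGraph c).support → ∃ i, d ∈ c i ∨ Γ.rev d ∈ c i := by
  rintro ⟨d', -, i, h | h⟩
  · exact ⟨i, Or.inr (by simpa using h.subset (List.mem_cons_self ..))⟩
  · exact ⟨i, Or.inl (by simpa using h.subset (List.mem_cons_of_mem _ (List.mem_cons_self ..)))⟩

theorem exists_succ_infix {A : Type*} {l : List A} {a : A} (h : a ∈ l) :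
    ∃ b, [a, b] <:+: l ++ l := by
  obtain ⟨s, t, rfl⟩ := List.append_of_mem h
  cases t with
  | nil =>
    cases s with
    | nil => exact ⟨a, [], [], by simp⟩
    | cons b s => exact ⟨b, b :: s, s ++ [a], by simp⟩
  | cons b t => exact ⟨b, s, t ++ (s ++ a :: b :: t), by simp⟩

theorem exists_pred_infix {A : Type*} {l : List A} {a : A} (h : a ∈ l) :
    ∃ b, [b, a] <:+: l ++ l := by
  obtain ⟨s, t, rfl⟩ := List.append_of_mem h
  obtain ⟨s', b, hb⟩ : ∃ s' b, s' ++ [b] = s ++ a :: t :=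
    ⟨_, _, List.dropLast_append_getLast (by simp)⟩
  cases List.eq_nil_or_concat s with
  | inl hs =>
    subst hs
    refine ⟨b, s', t, ?_⟩
    simp only [List.nil_append] at hb ⊢
    have h2 : a :: t ++ a :: t = s' ++ [b] ++ a :: t := by rw [hb]
    simp [h2]
  | inr hs =>
    obtain ⟨s'', x, rfl⟩ := hs
    exact ⟨x, s'', t ++ ((s'' ++ [x]) ++ a :: t), by simp⟩

/-- A closed path that crosses an edge also continues before and after it, possibly across the seam
of `c i ++ c i`, and reducedness makes the resulting turn nondegenerate. Hence the support of the
turn graph is the full set of directions on crossed edges. -/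
theorem IsReducedFamily.mem_support {c : ι → List Γ.E} (hc : Γ.IsReducedFamily c) {d : Γ.E}
    {i : ι} (h : d ∈ c i ∨ Γ.rev d ∈ c i) : d ∈ (Γ.turnGraph c).support := by
  rcases h with h | h
  · obtain ⟨b, hb⟩ := exists_pred_infix h
    refine ⟨Γ.rev b, ⟨fun hh => hc i _ _ hb hh, i, Or.inr ?_⟩⟩
    rwa [rev_rev]
  · obtain ⟨b, hb⟩ := exists_succ_infix h
    exact ⟨b, fun hh => hc i _ _ hb (by rw [rev_rev, hh]), i, Or.inl hb⟩

theorem IsReducedFamily.rev_mem_support {c : ι → List Γ.E} (hc : Γ.IsReducedFamily c) {d : Γ.E}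
    (h : d ∈ (Γ.turnGraph c).support) : Γ.rev d ∈ (Γ.turnGraph c).support := by
  obtain ⟨i, hi⟩ := mem_support_turnGraph h
  exact hc.mem_support (i := i) (by rw [rev_rev]; exact hi.symm)

end Turns

end SerreGraph

namespace SerreGraph

/-! ### Folding -/

open Classical in
/-- The map of vertices that identifies the endpoint of `e₂` with the endpoint of `e₁`. -/
noncomputable def foldVert (G : SerreGraph) (e₁ e₂ : G.E) (v : G.V) : G.V :=
  if v = G.tgt e₂ then G.tgt e₁ else v

/-- The graph obtained by folding `e₂` onto `e₁`. -/
noncomputable def fold (G : SerreGraph) (e₁ e₂ : G.E) : SerreGraph where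
  V := G.V
  E := {e : G.E // e ≠ e₂ ∧ e ≠ G.rev e₂}
  src e := G.foldVert e₁ e₂ (G.src e.1)
  rev e := ⟨G.rev e.1, fun h => e.2.2 (((G.rev_rev e.1).symm.trans (congrArg G.rev h))),
    fun h => e.2.1 (rev_injective h)⟩
  rev_rev e := Subtype.ext (G.rev_rev e.1)
  rev_ne e h := G.rev_ne e.1 (congrArg Subtype.val h)

section Fold

variable {G : SerreGraph} {e₁ e₂ : G.E}

theorem foldVert_tgt : G.foldVert e₁ e₂ (G.tgt e₁) = G.tgt e₁ := by
  unfold foldVert; split_ifs <;> rfl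

theorem foldVert_tgt' : G.foldVert e₁ e₂ (G.tgt e₂) = G.tgt e₁ := if_pos rfl

variable (G e₁ e₂) in
open Classical in
/-- The map of edges that replaces `e₂` by `e₁`. -/
noncomputable def foldEdge (e : G.E) : G.E :=
  if e = e₂ then e₁ else if e = G.rev e₂ then G.rev e₁ else e

theorem foldEdge_self : G.foldEdge e₁ e₂ e₂ = e₁ := if_pos rfl

theorem foldEdge_rev_self : G.foldEdge e₁ e₂ (G.rev e₂) = G.rev e₁ := by
  rw [foldEdge, if_neg (G.rev_ne e₂), if_pos rfl]

theorem foldEdge_of_ne {e : G.E} (h : e ≠ e₂) (h' : e ≠ G.rev e₂) : G.foldEdge e₁ e₂ e = e := by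
  rw [foldEdge, if_neg h, if_neg h']

theorem foldEdge_rev (e : G.E) : G.foldEdge e₁ e₂ (G.rev e) = G.rev (G.foldEdge e₁ e₂ e) := by
  by_cases h : e = e₂
  · rw [h, foldEdge_self, foldEdge_rev_self]
  · by_cases h' : e = G.rev e₂
    · rw [h', foldEdge_rev_self, rev_rev, rev_rev, foldEdge_self]
    · rw [foldEdge_of_ne h h', foldEdge_of_ne]
      · exact fun hh => h' (by rw [← hh, rev_rev])
      · exact fun hh => h (rev_injective hh)

theorem foldEdge_ne (hne : e₁ ≠ e₂) (hrev : e₁ ≠ G.rev e₂) (e : G.E) :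
    G.foldEdge e₁ e₂ e ≠ e₂ ∧ G.foldEdge e₁ e₂ e ≠ G.rev e₂ := by
  unfold foldEdge
  split_ifs with h h'
  · exact ⟨hne, hrev⟩
  · exact ⟨fun h => hrev (by rw [← h, rev_rev]), fun h => hne (rev_injective h)⟩
  · exact ⟨h, h'⟩

theorem foldVert_src_foldEdge (hsrc : G.src e₁ = G.src e₂) (e : G.E) :
    G.foldVert e₁ e₂ (G.src (G.foldEdge e₁ e₂ e)) = G.foldVert e₁ e₂ (G.src e) := by
  unfold foldEdge
  split_ifs with h h'
  · rw [h, hsrc]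
  · rw [h', src_rev, src_rev, foldVert_tgt, foldVert_tgt']
  · rfl

theorem foldEdge_eq {a b : G.E} (h : G.foldEdge e₁ e₂ a = G.foldEdge e₁ e₂ b) :
    a = b ∨ (a = e₁ ∧ b = e₂) ∨ (a = e₂ ∧ b = e₁) ∨ (a = G.rev e₁ ∧ b = G.rev e₂) ∨
      (a = G.rev e₂ ∧ b = G.rev e₁) := by
  unfold foldEdge at h
  split_ifs at h with ha hb hb ha' hb hb hb hb
  · exact Or.inl (ha.trans hb.symm)
  · exact absurd h.symm (G.rev_ne e₁)
  · exact Or.inr (Or.inr (Or.inl ⟨ha, h.symm⟩))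
  · exact absurd h (G.rev_ne e₁)
  · exact Or.inl (ha'.trans hb.symm)
  · exact Or.inr (Or.inr (Or.inr (Or.inr ⟨ha', h.symm⟩)))
  · exact Or.inr (Or.inl ⟨h, hb⟩)
  · exact Or.inr (Or.inr (Or.inr (Or.inl ⟨h, hb⟩)))
  · exact Or.inl h

/-- The folding map. -/
noncomputable def foldHom (hsrc : G.src e₁ = G.src e₂) (hne : e₁ ≠ e₂) (hrev : e₁ ≠ G.rev e₂) :
    G.Hom (G.fold e₁ e₂) where
  vert := G.foldVert e₁ e₂
  edge e := ⟨G.foldEdge e₁ e₂ e, foldEdge_ne hne hrev e⟩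
  src_edge e := foldVert_src_foldEdge hsrc e
  rev_edge e := Subtype.ext (foldEdge_rev e)

variable (hsrc : G.src e₁ = G.src e₂) (hne : e₁ ≠ e₂) (hrev : e₁ ≠ G.rev e₂)

theorem foldHom_edge_coe (e : (G.fold e₁ e₂).E) : (foldHom hsrc hne hrev).edge e.1 = e :=
  Subtype.ext (foldEdge_of_ne e.2.1 e.2.2)

theorem foldHom_edge₁₂ : (foldHom hsrc hne hrev).edge e₁ = (foldHom hsrc hne hrev).edge e₂ :=
  Subtype.ext ((foldEdge_of_ne hne hrev).trans foldEdge_self.symm)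

/-- The only identifications made by a fold. -/
theorem foldHom_edge_eq {a b : G.E}
    (h : (foldHom hsrc hne hrev).edge a = (foldHom hsrc hne hrev).edge b) :
    a = b ∨ (a = e₁ ∧ b = e₂) ∨ (a = e₂ ∧ b = e₁) ∨ (a = G.rev e₁ ∧ b = G.rev e₂) ∨
      (a = G.rev e₂ ∧ b = G.rev e₁) :=
  foldEdge_eq (congrArg Subtype.val h)

/-- Edge paths lift through a fold. -/
theorem exists_lift_foldHom {u w : G.V} {l : List (G.fold e₁ e₂).E}
    (h : (G.fold e₁ e₂).IsEdgePath (G.foldVert e₁ e₂ u) l (G.foldVert e₁ e₂ w)) :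
    ∃ l', G.IsEdgePath u l' w ∧
      (G.fold e₁ e₂).pathClass (l'.map (foldHom hsrc hne hrev).edge) =
        (G.fold e₁ e₂).pathClass l := by
  -- Distinct vertices that become equal are the endpoints of `e₁` and `e₂`. They are joined by a
  -- path through the common source, across one edge backwards and the other forwards, which the
  -- fold turns into a backtrack.
  have hconn : ∀ u w : G.V, G.foldVert e₁ e₂ u = G.foldVert e₁ e₂ w → ∃ l', G.IsEdgePath u l' w ∧
      (G.fold e₁ e₂).pathClass (l'.map (foldHom hsrc hne hrev).edge) = 1 := by
    intro u w huw
    unfold foldVert at huw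
    split_ifs at huw with h1 h2 h2
    · exact ⟨[], h1.trans h2.symm, rfl⟩
    · refine ⟨[G.rev e₂, e₁], ⟨h1.symm, ?_, huw⟩, ?_⟩
      · rw [tgt_rev, hsrc]
      · simp [Hom.rev_edge, foldHom_edge₁₂ hsrc hne hrev, edgeClass_rev]
    · refine ⟨[G.rev e₁, e₂], ⟨huw.symm, ?_, h2.symm⟩, ?_⟩
      · rw [tgt_rev, hsrc]
      · simp [Hom.rev_edge, foldHom_edge₁₂ hsrc hne hrev, edgeClass_rev]
    · exact ⟨[], huw, rfl⟩
  induction l generalizing u with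
  | nil =>
    obtain ⟨l', hl', hc⟩ := hconn u w h
    exact ⟨l', hl', by simp [hc]⟩
  | cons e l ih =>
    obtain ⟨m, hm, hmc⟩ := hconn u (G.src e.1) h.1.symm
    obtain ⟨l', hl', hc⟩ := ih (u := G.tgt e.1) h.2
    refine ⟨m ++ e.1 :: l', hm.append ⟨rfl, hl'⟩, ?_⟩
    rw [List.map_append, pathClass_append, hmc, one_mul, List.map_cons, pathClass_cons, hc,
      foldHom_edge_coe, pathClass_cons]

/-- A morphism that identifies `e₁` and `e₂` factors through the fold. -/
def foldDesc {H : SerreGraph} (f : G.Hom H) (he : f.edge e₁ = f.edge e₂) :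
    (G.fold e₁ e₂).Hom H where
  vert := f.vert
  edge e := f.edge e.1
  src_edge e := by
    rw [f.src_edge]
    show _ = f.vert (G.foldVert e₁ e₂ _)
    unfold foldVert
    split_ifs with h
    · rw [h, ← f.tgt_edge, ← f.tgt_edge, he]
    · rfl
  rev_edge e := f.rev_edge e.1

theorem foldDesc_foldHom {H : SerreGraph} (f : G.Hom H) (he : f.edge e₁ = f.edge e₂) (e : G.E) :
    (foldDesc f he).edge ((foldHom hsrc hne hrev).edge e) = f.edge e := by
  show f.edge (G.foldEdge e₁ e₂ e) = f.edge e
  unfold foldEdge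
  split_ifs with h h'
  · rw [h, he]
  · rw [h', f.rev_edge, f.rev_edge, he]
  · rfl

theorem foldDesc_foldVert {H : SerreGraph} (f : G.Hom H) (he : f.edge e₁ = f.edge e₂) (v : G.V) :
    f.vert (G.foldVert e₁ e₂ v) = f.vert v := by
  unfold foldVert
  split_ifs with h
  · rw [h, ← f.tgt_edge, ← f.tgt_edge, he]
  · rfl

end Fold

/-! ### The folding induction -/

section Unfolding

variable {ι : Type*} {H : SerreGraph}

/-- A morphism `f : Γ → H` that induces an isomorphism of fundamental groups at `b`, together
with a family of closed edge paths of `Γ` with a good turn graph. -/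
structure IsUnfolding {Γ : SerreGraph} (f : Γ.Hom H) (b : Γ.V) (c : ι → List Γ.E) : Prop where
  finite : Finite Γ.E
  connected : ∀ e, ∃ l, Γ.IsEdgePath b l (Γ.src e)
  injective : ∀ l, Γ.IsEdgePath b l b → H.pathClass (l.map f.edge) = 1 → Γ.pathClass l = 1
  surjective : ∀ l, H.IsEdgePath (f.vert b) l (f.vert b) →
    ∃ l', Γ.IsEdgePath b l' b ∧ H.pathClass (l'.map f.edge) = H.pathClass l
  cyclic : Γ.IsCyclicFamily c
  reduced : H.IsReducedFamily fun i => (c i).map f.edge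
  good : (Γ.turnGraph c).HasDisjointEdges ∨ (Γ.turnGraph c).HasCutVertex

namespace IsUnfolding

variable {Γ : SerreGraph} {f : Γ.Hom H} {b : Γ.V} {c : ι → List Γ.E}

/-- If the endpoints agreed, `e₁` followed by `rev e₂` would be a nonempty reduced loop, hence of
nontrivial class, while its image in `H` is trivial. Conjugation by a path from `b` contradicts
injectivity on the fundamental group. -/
theorem tgt_ne (h : IsUnfolding f b c) {e₁ e₂ : Γ.E} (hsrc : Γ.src e₁ = Γ.src e₂)
    (he : f.edge e₁ = f.edge e₂) (hne : e₁ ≠ e₂) : Γ.tgt e₁ ≠ Γ.tgt e₂ := by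
  intro ht
  obtain ⟨m, hm⟩ := h.connected e₁
  have hp : Γ.IsEdgePath (Γ.src e₁) [e₁, Γ.rev e₂] (Γ.src e₁) :=
    ⟨rfl, ht.symm, by rw [tgt_rev, hsrc]; rfl⟩
  have := h.injective _ ((hm.append hp).append hm.reverse) (by
    rw [← Hom.map_pathClass, pathClass_append, pathClass_append, pathClass_reversePath]
    simp [Hom.map_edgeClass, he, edgeClass_rev])
  have h1 : Γ.pathClass [e₁, Γ.rev e₂] = 1 := by
    rw [pathClass_append, pathClass_append, pathClass_reversePath] at this
    exact conj_eq_one_iff.1 this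
  have hr : Γ.IsReducedPath [e₁, Γ.rev e₂] :=
    List.isChain_cons_cons.2 ⟨fun hh => hne (rev_injective hh).symm, List.isChain_singleton _⟩
  have := hr.eq_of_pathClass_eq (l' := []) List.IsChain.nil h1
  simp at this

/-- The turn graph of the folded family is good. -/
theorem good_fold (h : IsUnfolding f b c) {e₁ e₂ : Γ.E} (hsrc : Γ.src e₁ = Γ.src e₂)
    (he : f.edge e₁ = f.edge e₂) (hne : e₁ ≠ e₂) (hrev : e₁ ≠ Γ.rev e₂)
    (hred : (Γ.fold e₁ e₂).IsReducedFamily fun i => (c i).map (foldHom hsrc hne hrev).edge) :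
    ((Γ.fold e₁ e₂).turnGraph fun i => (c i).map (foldHom hsrc hne hrev).edge).HasDisjointEdges ∨
    ((Γ.fold e₁ e₂).turnGraph fun i => (c i).map (foldHom hsrc hne hrev).edge).HasCutVertex := by
  have him := isImage_turnGraph (foldHom hsrc hne hrev) hred
  have hΓ : Γ.IsReducedFamily c := h.reduced.of_map
  have ht := h.tgt_ne hsrc he hne
  -- The case distinction is whether the family crosses both `e₁` and `e₂`. If so, the directions
  -- `rev e₁` and `rev e₂`, which sit at different vertices, are glued to a cut vertex; the
  -- simultaneous gluing of `e₁` and `e₂` takes place at a single vertex of `Γ` and is harmless. If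
  -- not, no two directions in use are identified.
  by_cases hs : Γ.rev e₁ ∈ (Γ.turnGraph c).support ∧ Γ.rev e₂ ∈ (Γ.turnGraph c).support
  · right
    have h12 : (foldHom hsrc hne hrev).edge (Γ.rev e₁) = (foldHom hsrc hne hrev).edge (Γ.rev e₂) := by
      rw [Hom.rev_edge, Hom.rev_edge, foldHom_edge₁₂]
    refine him.hasCutVertex_of_glue Γ.src (fun a b hab => h.cyclic.src_eq hab) h12 ht ?_ hs.1 hs.2
    intro x y hxy hx
    rcases foldHom_edge_eq hsrc hne hrev hxy with rfl | ⟨rfl, rfl⟩ | ⟨rfl, rfl⟩ | ⟨rfl, rfl⟩ |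
      ⟨rfl, rfl⟩
    · rfl
    · exact hsrc
    · exact hsrc.symm
    · exact absurd rfl hx
    · exact absurd h12.symm hx
  · have hs' : ∀ e e', (e = Γ.rev e₁ ∧ e' = Γ.rev e₂) ∨ (e = Γ.rev e₂ ∧ e' = Γ.rev e₁) →
        e ∈ (Γ.turnGraph c).support → e' ∈ (Γ.turnGraph c).support → False := by
      rintro e e' (⟨rfl, rfl⟩ | ⟨rfl, rfl⟩) h1 h2
      · exact hs ⟨h1, h2⟩
      · exact hs ⟨h2, h1⟩
    have hinj : Set.InjOn (foldHom hsrc hne hrev).edge (Γ.turnGraph c).support := by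
      intro x hx y hy hxy
      have hx' := hΓ.rev_mem_support hx
      have hy' := hΓ.rev_mem_support hy
      rcases foldHom_edge_eq hsrc hne hrev hxy with rfl | ⟨rfl, rfl⟩ | ⟨rfl, rfl⟩ | ⟨rfl, rfl⟩ |
        ⟨rfl, rfl⟩
      · rfl
      · exact (hs' _ _ (Or.inl ⟨rfl, rfl⟩) hx' hy').elim
      · exact (hs' _ _ (Or.inr ⟨rfl, rfl⟩) hx' hy').elim
      · exact (hs' _ _ (Or.inl ⟨rfl, rfl⟩) hx hy).elim
      · exact (hs' _ _ (Or.inr ⟨rfl, rfl⟩) hx hy).elim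
    exact h.good.imp (him.hasDisjointEdges hinj) (him.hasCutVertex hinj)

/-- Loops of the folded graph lift to loops of `Γ` up to class, which transfers injectivity;
surjectivity is transferred by pushing loops forward. The vertex set is not shrunk by a fold, so the
old endpoint of `e₂` survives as an isolated vertex; this is why connectedness is demanded only for
sources of edges. -/
theorem fold (h : IsUnfolding f b c) {e₁ e₂ : Γ.E} (hsrc : Γ.src e₁ = Γ.src e₂)
    (he : f.edge e₁ = f.edge e₂) (hne : e₁ ≠ e₂) (hrev : e₁ ≠ Γ.rev e₂) :
    IsUnfolding (foldDesc f he) (Γ.foldVert e₁ e₂ b)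
      fun i => (c i).map (foldHom hsrc hne hrev).edge := by
  have := h.finite
  have hcomp : ∀ l : List Γ.E, (l.map (foldHom hsrc hne hrev).edge).map (foldDesc f he).edge =
      l.map f.edge := by
    intro l
    rw [List.map_map]
    exact List.map_congr_left fun e _ => foldDesc_foldHom hsrc hne hrev f he e
  have hred : H.IsReducedFamily fun i =>
      ((c i).map (foldHom hsrc hne hrev).edge).map (foldDesc f he).edge := by
    simpa only [hcomp] using h.reduced
  refine ⟨Subtype.finite, fun e => ?_, fun l hl hl1 => ?_, fun l hl => ?_, h.cyclic.map _, hred,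
    h.good_fold hsrc he hne hrev (.of_map _ hred)⟩
  · obtain ⟨l, hl⟩ := h.connected e.1
    exact ⟨_, (foldHom hsrc hne hrev).isEdgePath hl⟩
  · obtain ⟨l', hl', hc⟩ := exists_lift_foldHom hsrc hne hrev hl
    have : Γ.pathClass l' = 1 := by
      refine h.injective l' hl' ?_
      rw [← hcomp, ← Hom.map_pathClass, hc, Hom.map_pathClass, hl1]
    rw [← hc, ← Hom.map_pathClass, this, map_one]
  · replace hl : H.IsEdgePath (f.vert (Γ.foldVert e₁ e₂ b)) l (f.vert (Γ.foldVert e₁ e₂ b)) := hl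
    rw [foldDesc_foldVert f he] at hl
    obtain ⟨l', hl', hc⟩ := h.surjective l hl
    exact ⟨_, (foldHom hsrc hne hrev).isEdgePath hl', by rw [hcomp, hc]⟩

end IsUnfolding

/-- Induction on the number of edges, which drops with each fold. When no fold is possible, the
morphism is an immersion, hence injective on edges, and the turn graph is carried over unchanged. -/
theorem IsUnfolding.good_map {Γ : SerreGraph} {f : Γ.Hom H} {b : Γ.V} {c : ι → List Γ.E}
    (h : IsUnfolding f b c) : (H.turnGraph fun i => (c i).map f.edge).HasDisjointEdges ∨
      (H.turnGraph fun i => (c i).map f.edge).HasCutVertex := by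
  induction hN : Nat.card Γ.E using Nat.strong_induction_on generalizing Γ with
  | _ N ih =>
  have := h.finite
  by_cases hf : f.IsImmersion
  · have hinj := (hf.edge_injective h.connected h.surjective).injOn (s := (Γ.turnGraph c).support)
    have him := isImage_turnGraph f h.reduced
    exact h.good.imp (him.hasDisjointEdges hinj) (him.hasCutVertex hinj)
  · unfold Hom.IsImmersion at hf
    push Not at hf
    obtain ⟨e₁, e₂, hsrc, he, hne⟩ := hf
    -- An edge and its reverse never have the same image, because reversal in `H` has no fixed edge.
    have hrev : e₁ ≠ Γ.rev e₂ := by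
      rintro rfl
      exact H.rev_ne _ (by rw [← f.rev_edge, he])
    have := ih _ ?_ (h.fold hsrc he hne hrev) rfl
    · simpa only [List.map_map, Function.comp_def, foldDesc_foldHom] using this
    · rw [← hN]
      exact Finite.card_subtype_lt (x := e₂) (by simp)

end Unfolding

end SerreGraph

namespace SerreGraph

/-! ### Subdivided graphs over a given graph -/

section EdgePathAux

variable {H : SerreGraph} {u w : H.V} {l : List H.E}

theorem IsEdgePath.src_getElem_zero (h : H.IsEdgePath u l w) (hl : 0 < l.length) :
    H.src l[0] = u := by
  cases l with
  | nil => simp at hl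
  | cons e l => exact h.1

theorem IsEdgePath.tgt_getElem (h : H.IsEdgePath u l w) {i : ℕ} (hi : i < l.length) :
    H.IsEdgePath (H.tgt l[i]) (l.drop (i + 1)) w := by
  rw [← List.take_append_drop i l] at h
  obtain ⟨v, -, hv⟩ := isEdgePath_append.1 h
  rw [List.drop_eq_getElem_cons hi] at hv
  exact hv.2

theorem IsEdgePath.src_getElem_succ (h : H.IsEdgePath u l w) {i : ℕ} (hi : i + 1 < l.length) :
    H.src l[i + 1] = H.tgt l[i] := by
  have := h.tgt_getElem (i := i) (by omega)
  rw [List.drop_eq_getElem_cons hi] at this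
  exact this.1

theorem IsEdgePath.tgt_getElem_last (h : H.IsEdgePath u l w) {i : ℕ} (hi : i + 1 = l.length) :
    H.tgt (l[i]'(by omega)) = w := by
  have := h.tgt_getElem (i := i) (by omega)
  rw [List.drop_eq_nil_of_le (by omega)] at this
  exact this

end EdgePathAux

section Subdivision

variable {H : SerreGraph} {V₀ A : Type} (s t : A → V₀) (word : A → List H.E)

open Classical in
/-- The `j`-th vertex on the arc `a`. -/
noncomputable def arcVertex (a : A) (j : ℕ) : V₀ ⊕ A × ℕ :=
  if j = 0 then Sum.inl (s a) else if j = (word a).length then Sum.inl (t a) else Sum.inr (a, j)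

/-- The graph with an arc from `s a` to `t a` for each `a`, subdivided into as many edges as
`word a` has. -/
noncomputable def subdivision : SerreGraph where
  V := V₀ ⊕ A × ℕ
  E := {p : A × ℕ // p.2 < (word p.1).length} × Bool
  src e := arcVertex s t word e.1.1.1 (if e.2 then e.1.1.2 else e.1.1.2 + 1)
  rev e := (e.1, !e.2)
  rev_rev := by simp
  rev_ne := by simp [Prod.ext_iff]

/-- The arc `a` as an edge path. -/
def arc (a : A) : List (subdivision s t word).E :=
  List.ofFn fun i : Fin (word a).length => (⟨(a, i), i.2⟩, true)

variable {s t word}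

@[simp] theorem length_arc (a : A) : (arc s t word a).length = (word a).length :=
  List.length_ofFn

theorem arc_getElem (a : A) (i : ℕ) (h : i < (arc s t word a).length) :
    (arc s t word a)[i] = (⟨(a, i), by simpa using h⟩, true) :=
  List.getElem_ofFn ..

theorem arcVertex_zero (a : A) : arcVertex s t word a 0 = Sum.inl (s a) := if_pos rfl

theorem arcVertex_length (a : A) (h : word a ≠ []) :
    arcVertex s t word a (word a).length = Sum.inl (t a) := by
  unfold arcVertex
  rw [if_neg (by simpa using h), if_pos rfl]

theorem isEdgePath_take_arc (a : A) {j : ℕ} (hj : j ≤ (word a).length) :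
    (subdivision s t word).IsEdgePath (Sum.inl (s a)) ((arc s t word a).take j)
      (arcVertex s t word a j) := by
  induction j with
  | zero => exact (arcVertex_zero a).symm
  | succ j ih =>
    have hj' : j < (arc s t word a).length := by simpa using hj
    rw [← List.take_concat_get' _ j hj', arc_getElem]
    exact (ih (by omega)).append ⟨rfl, rfl⟩

theorem isEdgePath_arc (a : A) (h : word a ≠ []) :
    (subdivision s t word).IsEdgePath (Sum.inl (s a)) (arc s t word a) (Sum.inl (t a)) := by
  have := isEdgePath_take_arc (s := s) (t := t) (word := word) a le_rfl
  rwa [arcVertex_length a h, List.take_of_length_le (by simp)] at this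

open Classical in
/-- The map of vertices that realizes the labelling of the arcs. -/
noncomputable def subdivisionVert (t : A → V₀) (word : A → List H.E) (f₀ : V₀ → H.V) :
    V₀ ⊕ A × ℕ → H.V
  | Sum.inl v => f₀ v
  -- The default value concerns only pairs `(a, j)` beyond the arc, which are isolated vertices of
  -- the subdivision.
  | Sum.inr (a, j) => if h : j < (word a).length then H.src (word a)[j] else f₀ (t a)

variable {f₀ : V₀ → H.V} (hword : ∀ a, H.IsEdgePath (f₀ (s a)) (word a) (f₀ (t a)))

include hword in
theorem subdivisionVert_of_lt (a : A) {j : ℕ} (hj : j < (word a).length) :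
    subdivisionVert t word f₀ (arcVertex s t word a j) = H.src (word a)[j] := by
  unfold arcVertex
  split_ifs with h
  · subst h
    exact ((hword a).src_getElem_zero hj).symm
  · omega
  · simp [subdivisionVert, hj]

include hword in
theorem subdivisionVert_succ (a : A) {j : ℕ} (hj : j < (word a).length) :
    subdivisionVert t word f₀ (arcVertex s t word a (j + 1)) = H.tgt (word a)[j] := by
  rcases Nat.lt_or_ge (j + 1) (word a).length with h | h
  · rw [subdivisionVert_of_lt hword a h, (hword a).src_getElem_succ h]
  · have h' : j + 1 = (word a).length := by omega
    rw [h', arcVertex_length a (by rintro h0; simp [h0] at hj), (hword a).tgt_getElem_last h']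
    rfl

/-- The morphism that maps the arc `a` to the edge path `word a`. -/
noncomputable def subdivisionHom : (subdivision s t word).Hom H where
  vert := subdivisionVert t word f₀
  edge e := if e.2 then (word e.1.1.1)[e.1.1.2]'e.1.2 else H.rev ((word e.1.1.1)[e.1.1.2]'e.1.2)
  src_edge := by
    rintro ⟨⟨⟨a, i⟩, hi⟩, b⟩
    cases b
    · exact (subdivisionVert_succ hword a hi).symm
    · exact (subdivisionVert_of_lt hword a hi).symm
  rev_edge := by
    rintro ⟨⟨⟨a, i⟩, hi⟩, b⟩
    cases b
    · exact (H.rev_rev _).symm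
    · rfl

theorem map_arc (a : A) : (arc s t word a).map (subdivisionHom hword).edge = word a := by
  refine List.ext_getElem (by simp) fun i h h' => ?_
  rw [List.getElem_map, arc_getElem]
  rfl

/-- The fundamental group of a subdivided graph is generated by the loops that run from the base
point to the beginning of an arc, along the arc, and back to the base point. -/
theorem pathClass_mem_of_arc_mem
    (S : Subgroup (FreeGroup (subdivision s t word).E))
    (q : V₀ → FreeGroup (subdivision s t word).E)
    (hS : ∀ a, q (s a) * (subdivision s t word).pathClass (arc s t word a) * (q (t a))⁻¹ ∈ S)
    {o : V₀} (ho : q o = 1) {l : List (subdivision s t word).E}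
    (hl : (subdivision s t word).IsEdgePath (Sum.inl o) l (Sum.inl o)) :
    (subdivision s t word).pathClass l ∈ S := by
  let Γ := subdivision s t word
  -- `Q` plays the role of a chosen path from the base point to each vertex: `q` at the original
  -- vertices and, inside an arc, `q` at its beginning followed by the initial piece of the arc.
  -- Relative to these choices every edge contributes an element of `S`, and the contributions
  -- telescope along `l`.
  let r : A → ℕ → FreeGroup Γ.E := fun a j => q (s a) * Γ.pathClass ((arc s t word a).take j)
  let Q : Γ.V → FreeGroup Γ.E := Sum.elim q fun p => r p.1 p.2
  -- The two ways to reach the `j`-th vertex of an arc agree except at its end, and there the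
  -- discrepancy is the element supplied by `hS`.
  have hr : ∀ a j, j ≤ (word a).length → r a j * (Q (arcVertex s t word a j))⁻¹ ∈ S := by
    intro a j hj
    unfold arcVertex
    split_ifs with h h'
    · subst h
      simp [r, Q, S.one_mem]
    · simp only [r, Q, Sum.elim_inl]
      rw [List.take_of_length_le (by rw [length_arc, h'])]
      exact hS a
    · simp [r, Q, S.one_mem]
  have hfwd : ∀ (a : A) (i : ℕ) (hi : i < (word a).length),
      Q (arcVertex s t word a i) * Γ.edgeClass (⟨(a, i), hi⟩, true) *
        (Q (arcVertex s t word a (i + 1)))⁻¹ ∈ S := by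
    intro a i hi
    have h1 := S.mul_mem (S.inv_mem (hr a i hi.le)) (hr a (i + 1) hi)
    have h2 : r a (i + 1) = r a i * Γ.edgeClass (⟨(a, i), hi⟩, true) := by
      have hi' : i < (arc s t word a).length := by simpa using hi
      simp only [r]
      rw [← List.take_concat_get' _ i hi', arc_getElem, pathClass_append, mul_assoc]
      exact congrArg _ (congrArg _ (mul_one _))
    rw [h2] at h1
    convert h1 using 1
    group
  have hedge : ∀ e : Γ.E, Q (Γ.src e) * Γ.edgeClass e * (Q (Γ.tgt e))⁻¹ ∈ S := by
    rintro ⟨⟨⟨a, i⟩, hi⟩, b⟩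
    cases b
    · have h1 := S.inv_mem (hfwd a i hi)
      have h2 : Γ.edgeClass (⟨(a, i), hi⟩, false) = (Γ.edgeClass (⟨(a, i), hi⟩, true))⁻¹ :=
        edgeClass_rev (G := Γ) (⟨(a, i), hi⟩, true)
      rw [h2]
      convert h1 using 1
      rw [mul_inv_rev, mul_inv_rev, inv_inv, mul_assoc]
      rfl
    · exact hfwd a i hi
  have hpath : ∀ (l : List Γ.E) (u w : Γ.V), Γ.IsEdgePath u l w →
      Q u * Γ.pathClass l * (Q w)⁻¹ ∈ S := by
    intro l
    induction l with
    | nil =>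
      intro u w h
      cases h
      simp [S.one_mem]
    | cons e l ih =>
      rintro u w ⟨rfl, h⟩
      convert S.mul_mem (hedge e) (ih _ _ h) using 1
      rw [pathClass_cons]
      group
  simpa [Q, ho] using hpath l _ _ hl

theorem exists_getElem_of_infix {B : Type*} {l : List B} {x y : B} (h : [x, y] <:+: l) :
    ∃ (k : ℕ) (hk : k + 1 < l.length), l[k] = x ∧ l[k + 1] = y := by
  obtain ⟨l₁, l₂, rfl⟩ := h
  refine ⟨l₁.length, by simp, ?_, ?_⟩
  · simp
  · simp

theorem arc_append_getElem (a : A) (k : ℕ) (h : k < (arc s t word a ++ arc s t word a).length) :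
    (arc s t word a ++ arc s t word a)[k] =
      (⟨(a, k % (word a).length), Nat.mod_lt _ (by simp at h; omega)⟩, true) := by
  have h' : k < (word a).length + (word a).length := by simpa using h
  rw [List.getElem_append]
  split_ifs with hk
  · rw [arc_getElem]
    simp only [length_arc] at hk
    congr 4
    exact (Nat.mod_eq_of_lt hk).symm
  · rw [arc_getElem]
    simp only [length_arc, not_lt] at hk
    simp only [length_arc]
    congr 4
    rw [Nat.mod_eq_sub_mod hk, Nat.mod_eq_of_lt (by omega)]

theorem of_infix_arc {a : A} {x y : (subdivision s t word).E}
    (h : [x, y] <:+: arc s t word a ++ arc s t word a) :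
    x.2 = true ∧ y.2 = true ∧ x.1.1.1 = a ∧ y.1.1.1 = a ∧
      y.1.1.2 = (x.1.1.2 + 1) % (word a).length := by
  obtain ⟨k, hk, rfl, rfl⟩ := exists_getElem_of_infix h
  rw [arc_append_getElem, arc_append_getElem]
  simp

theorem subdivision_edge_ext {x y : (subdivision s t word).E} (h1 : x.1.1.1 = y.1.1.1)
    (h2 : x.1.1.2 = y.1.1.2) (h3 : x.2 = y.2) : x = y :=
  Prod.ext (Subtype.ext (Prod.ext h1 h2)) h3

/-- The turn graph of a family of arcs consists of disjoint edges. -/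
theorem hasDisjointEdges_arc {ι : Type*} (idx : ι → A) :
    ((subdivision s t word).turnGraph fun i => arc s t word (idx i)).HasDisjointEdges := by
  have hb : ∀ (d : (subdivision s t word).E), ((subdivision s t word).rev d).2 = !d.2 :=
    fun _ => rfl
  have hb1 : ∀ (d : (subdivision s t word).E), ((subdivision s t word).rev d).1 = d.1 :=
    fun _ => rfl
  -- Arcs cross edges only in the positive orientation. The orientation of `d` thus decides whether
  -- both neighbours are successors of `rev d` or both are reverses of predecessors of `d`; the
  -- mixed cases are contradictory.
  rintro d x y ⟨-, i, hx | hx⟩ ⟨-, j, hy | hy⟩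
  · obtain ⟨-, hx2, hx3, hx4, hx5⟩ := of_infix_arc hx
    obtain ⟨-, hy2, hy3, hy4, hy5⟩ := of_infix_arc hy
    have hij := hx3.symm.trans hy3
    exact subdivision_edge_ext (by rw [hx4, hy4, hij]) (by rw [hx5, hy5, hij]) (by rw [hx2, hy2])
  · have h1 := (of_infix_arc hx).1
    have h2 := (of_infix_arc hy).2.1
    rw [hb, h2] at h1
    simp at h1
  · have h1 := (of_infix_arc hx).2.1
    have h2 := (of_infix_arc hy).1
    rw [hb, h1] at h2
    simp at h2
  · obtain ⟨hx1, -, hx3, hx4, hx5⟩ := of_infix_arc hx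
    obtain ⟨hy1, -, hy3, hy4, hy5⟩ := of_infix_arc hy
    rw [hb1] at hx3 hy3 hx5 hy5
    have hij := hx4.symm.trans hy4
    refine subdivision_edge_ext (by rw [hx3, hy3, hij]) ?_ ?_
    -- Two positions below `n` with the same cyclic successor modulo `n` are equal.
    · have hxl := x.1.2
      have hyl := y.1.2
      rw [hx3] at hxl
      rw [hy3, ← hij] at hyl
      rw [hx5, hij] at hy5
      rw [hij] at hxl hyl
      generalize (word (idx j)).length = n at *
      rcases Nat.lt_or_ge (x.1.1.2 + 1) n with h | h <;>
        rcases Nat.lt_or_ge (y.1.1.2 + 1) n with h' | h'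
      · rw [Nat.mod_eq_of_lt h, Nat.mod_eq_of_lt h'] at hy5; omega
      · rw [Nat.mod_eq_of_lt h, show y.1.1.2 + 1 = n by omega, Nat.mod_self] at hy5; omega
      · rw [Nat.mod_eq_of_lt h', show x.1.1.2 + 1 = n by omega, Nat.mod_self] at hy5; omega
      · omega
    · rw [hb] at hx1 hy1
      simpa using hx1.trans hy1.symm

instance [Finite A] : Finite (subdivision s t word).E := by
  have : Finite {p : A × ℕ // p.2 < (word p.1).length} :=
    Finite.of_equiv (Σ a, Fin (word a).length)
      ⟨fun x => ⟨(x.1, x.2), x.2.2⟩, fun p => ⟨p.1.1, p.1.2, p.2⟩, fun _ => rfl, fun _ => rfl⟩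
  exact inferInstanceAs (Finite (_ × Bool))

end Subdivision

/-! ### Circuits that represent a part of a free basis -/

/-- Whitehead's cut vertex test for a basis of a free group that is identified with the
fundamental group of `H` at `o`, where the basis elements are written as lollipops. -/
theorem turnGraph_good_of_basis {F : Type} [Group F] {κ : Type} [Finite κ]
    (b : FreeGroupBasis κ F) {H : SerreGraph} {o : H.V} (θ : F →* FreeGroup H.E)
    (hinj : Function.Injective θ)
    (hsurj : ∀ l, H.IsEdgePath o l o → ∃ g, θ g = H.pathClass l)
    (v : κ → H.V) (p c : κ → List H.E) (hp : ∀ j, H.IsEdgePath o (p j) (v j))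
    (hc : ∀ j, H.IsEdgePath (v j) (c j) (v j)) (hp0 : ∀ j, p j ≠ []) (hc0 : ∀ j, c j ≠ [])
    (hθ : ∀ j, θ (b j) = H.pathClass (p j) * H.pathClass (c j) * (H.pathClass (p j))⁻¹)
    {ι : Type*} (idx : ι → κ) (hred : H.IsReducedFamily fun i => c (idx i)) :
    (H.turnGraph fun i => c (idx i)).HasDisjointEdges ∨
      (H.turnGraph fun i => c (idx i)).HasCutVertex := by
  -- The wedge of lollipops: `none` is the base vertex, the arc `(j, false)` is the stem from it to
  -- `some j`, and the arc `(j, true)` is the circle at `some j`.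
  let s : κ × Bool → Option κ := fun a => if a.2 then some a.1 else none
  let t : κ × Bool → Option κ := fun a => some a.1
  let word : κ × Bool → List H.E := fun a => if a.2 then c a.1 else p a.1
  let f₀ : Option κ → H.V := fun x => x.elim o v
  have hword : ∀ a, H.IsEdgePath (f₀ (s a)) (word a) (f₀ (t a)) := by
    rintro ⟨j, _ | _⟩
    · exact hp j
    · exact hc j
  have hne : ∀ a, word a ≠ [] := by
    rintro ⟨j, _ | _⟩
    · exact hp0 j
    · exact hc0 j
  let Γ := subdivision s t word
  let f : Γ.Hom H := subdivisionHom hword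
  let stem : κ → List Γ.E := fun j => arc s t word (j, false)
  let circ : κ → List Γ.E := fun j => arc s t word (j, true)
  have hstem : ∀ j, Γ.IsEdgePath (Sum.inl none) (stem j) (Sum.inl (some j)) :=
    fun j => isEdgePath_arc (j, false) (hne _)
  have hcirc : ∀ j, Γ.IsEdgePath (Sum.inl (some j)) (circ j) (Sum.inl (some j)) :=
    fun j => isEdgePath_arc (j, true) (hne _)
  have hfs : ∀ j, (stem j).map f.edge = p j := fun j => map_arc hword (j, false)
  have hfc : ∀ j, (circ j).map f.edge = c j := fun j => map_arc hword (j, true)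
  -- `Λ` identifies `F` with the group of classes of loops of `Γ` at the base vertex. Since `θ`
  -- factors as `f` after `Λ`, the injectivity and surjectivity of `θ` become those of `f`.
  let Λ : F →* FreeGroup Γ.E := b.lift fun j =>
    Γ.pathClass (stem j ++ circ j ++ reversePath (stem j))
  have hΛ : ∀ j, Λ (b j) = Γ.pathClass (stem j ++ circ j ++ reversePath (stem j)) :=
    fun j => by simp [Λ, FreeGroupBasis.lift]
  have hcomp : ∀ g, FreeGroup.map f.edge (Λ g) = θ g := by
    have : (FreeGroup.map f.edge).comp Λ = θ := by
      refine b.ext_hom _ _ fun j => ?_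
      rw [MonoidHom.comp_apply, hΛ, hθ, pathClass_append, pathClass_append, pathClass_reversePath,
        map_mul, map_mul, map_inv, f.map_pathClass, f.map_pathClass, hfs, hfc]
    exact fun g => DFunLike.congr_fun this g
  have hmem : ∀ l, Γ.IsEdgePath (Sum.inl none) l (Sum.inl none) → Γ.pathClass l ∈ Λ.range := by
    intro l hl
    -- With the stems as chosen paths, each stem contributes the trivial class and each circle
    -- contributes exactly `Λ (b j)`.
    refine pathClass_mem_of_arc_mem Λ.range
      (fun x => x.elim 1 fun j => Γ.pathClass (stem j)) ?_ rfl hl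
    rintro ⟨j, _ | _⟩
    · convert Λ.range.one_mem using 1
      show 1 * Γ.pathClass (stem j) * (Γ.pathClass (stem j))⁻¹ = 1
      group
    · refine ⟨b j, ?_⟩
      rw [hΛ, pathClass_append, pathClass_append, pathClass_reversePath]
      rfl
  have hloop : ∀ g, ∃ l, Γ.IsEdgePath (Sum.inl none) l (Sum.inl none) ∧ Γ.pathClass l = Λ g := by
    let L : Subgroup (FreeGroup Γ.E) :=
      { carrier := {x | ∃ l, Γ.IsEdgePath (Sum.inl none) l (Sum.inl none) ∧ Γ.pathClass l = x}
        mul_mem' := by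
          rintro _ _ ⟨l, hl, rfl⟩ ⟨l', hl', rfl⟩
          exact ⟨l ++ l', hl.append hl', pathClass_append _ _⟩
        one_mem' := ⟨[], rfl, rfl⟩
        inv_mem' := by
          rintro _ ⟨l, hl, rfl⟩
          exact ⟨_, hl.reverse, pathClass_reversePath l⟩ }
    intro g
    obtain ⟨w, rfl⟩ := b.repr.symm.surjective g
    show Λ (b.repr.symm w) ∈ L
    induction w using FreeGroup.induction_on with
    | C1 => simp
    | of j => exact ⟨_, ((hstem j).append (hcirc j)).append (hstem j).reverse, (hΛ j).symm⟩
    | inv_of j h => simpa using h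
    | mul x y hx hy => simpa using L.mul_mem hx hy
  have hunf : IsUnfolding f (Sum.inl none : Γ.V) fun i => circ (idx i) := by
    refine ⟨inferInstanceAs (Finite (subdivision s t word).E), ?_, ?_, ?_, ?_, ?_,
      Or.inl (hasDisjointEdges_arc fun i => (idx i, true))⟩
    · have hbase : ∀ x : Option κ, ∃ l, Γ.IsEdgePath (Sum.inl none) l (Sum.inl x) := by
        rintro (_ | j)
        · exact ⟨[], rfl⟩
        · exact ⟨stem j, hstem j⟩
      rintro ⟨⟨⟨a, i⟩, hi⟩, d⟩
      obtain ⟨l, hl⟩ := hbase (s a)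
      cases d
      · exact ⟨_, hl.append (isEdgePath_take_arc a (j := i + 1) hi)⟩
      · exact ⟨_, hl.append (isEdgePath_take_arc a (j := i) hi.le)⟩
    · intro l hl hl1
      obtain ⟨g, hg⟩ := hmem l hl
      rw [← f.map_pathClass, ← hg, hcomp] at hl1
      rw [← hg, hinj (hl1.trans (map_one θ).symm), map_one]
    · intro l hl
      obtain ⟨g, hg⟩ := hsurj l hl
      obtain ⟨l', hl', hl''⟩ := hloop g
      exact ⟨l', hl', by rw [← f.map_pathClass, hl'', hcomp, hg]⟩
    · intro i e e' h
      exact ((hcirc (idx i)).append (hcirc (idx i))).src_eq_tgt_of_infix h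
    · simpa only [hfc] using hred
  simpa only [hfc] using hunf.good_map

end SerreGraph

namespace SerreGraph

/-! ### From the turn graph to the Whitehead graphs -/

section Whitehead

variable {G : SerreGraph} {ι : Type*} (γ : ι → G.Circuit)

theorem isReducedFamily_edges : G.IsReducedFamily fun i => (γ i).edges :=
  fun i => (γ i).reduced

theorem isCyclicFamily_edges : G.IsCyclicFamily fun i => (γ i).edges :=
  fun i _ _ h => ((γ i).closed.append (γ i).closed).src_eq_tgt_of_infix h

variable {γ}

theorem turnGraph_adj_of_whiteheadGraph {v : G.V} {x y : (G.whiteheadGraph γ v).verts}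
    (h : (G.whiteheadGraph γ v).coe.Adj x y) :
    (G.turnGraph fun i => (γ i).edges).Adj x.1.1 y.1.1 :=
  ⟨fun hh => h.1 (Subtype.ext hh), h.2⟩

/-- The two directions of a turn issue from the same vertex, so each component of the turn graph
that has an edge lies inside one Whitehead graph. -/
theorem exists_whiteheadGraph_adj {v : G.V} (x : (G.whiteheadGraph γ v).verts) {e : G.E}
    (h : (G.turnGraph fun i => (γ i).edges).Adj x.1.1 e) :
    ∃ y : (G.whiteheadGraph γ v).verts, y.1.1 = e ∧ (G.whiteheadGraph γ v).coe.Adj x y := by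
  have hs := (isCyclicFamily_edges γ).src_eq h
  have hv := mem_support_turnGraph ⟨_, h.symm⟩
  exact ⟨⟨⟨e, hs.symm.trans x.1.2⟩, hv⟩, rfl, fun hh => h.1 (congrArg Subtype.val hh), h.2⟩

theorem exists_whiteheadGraph_reachable {v : G.V} {e e' : G.E}
    (p : (G.turnGraph fun i => (γ i).edges).Walk e e') (x : (G.whiteheadGraph γ v).verts)
    (hx : x.1.1 = e) :
    ∃ y : (G.whiteheadGraph γ v).verts, y.1.1 = e' ∧ (G.whiteheadGraph γ v).coe.Reachable x y := by
  induction p generalizing x with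
  | nil => exact ⟨x, hx, .refl x⟩
  | cons h p ih =>
    subst hx
    obtain ⟨z, hz, hxz⟩ := exists_whiteheadGraph_adj x h
    obtain ⟨y, hy, hzy⟩ := ih z hz
    exact ⟨y, hy, hxz.reachable.trans hzy⟩

theorem nearVisibility_of_hasDisjointEdges
    (h : (G.turnGraph fun i => (γ i).edges).HasDisjointEdges) : NearVisibility γ := by
  intro v C
  obtain ⟨x, rfl⟩ := C.exists_rep
  obtain ⟨i, hi⟩ := x.2
  obtain ⟨e, he⟩ := (isReducedFamily_edges γ).mem_support (i := i) hi
  obtain ⟨y, rfl, hxy⟩ := exists_whiteheadGraph_adj x he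
  refine ⟨⟨x, rfl⟩, ⟨y, SimpleGraph.ConnectedComponent.sound hxy.symm.reachable⟩, hxy, ?_⟩
  rintro ⟨z, hz⟩
  -- Every walk that starts in `{x, y}` oscillates between these two vertices, each being the only
  -- neighbour of the other.
  have key : ∀ {a b : (G.whiteheadGraph γ v).verts}, (G.whiteheadGraph γ v).coe.Walk a b →
      (a = x ∨ a = y) → (b = x ∨ b = y) := by
    intro a b p
    induction p with
    | nil => exact id
    | @cons a b c hab p ih =>
      intro ha
      refine ih ?_
      have hab' := turnGraph_adj_of_whiteheadGraph hab
      rcases ha with rfl | rfl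
      · exact Or.inr (Subtype.ext (Subtype.ext (h _ _ _ hab' he)))
      · exact Or.inl (Subtype.ext (Subtype.ext (h _ _ _ hab' he.symm)))
  obtain ⟨p⟩ := SimpleGraph.ConnectedComponent.exact (Eq.symm hz)
  exact (key p (Or.inl rfl)).imp Subtype.ext Subtype.ext

theorem cutVertexCondition_of_hasCutVertex
    (h : (G.turnGraph fun i => (γ i).edges).HasCutVertex) : CutVertexCondition γ := by
  obtain ⟨w, u, v, hu, hv, ⟨p⟩, hw⟩ := h
  obtain ⟨hus, -⟩ := SimpleGraph.mem_support_of_mem_walk p hu (hw p)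
  let x : (G.whiteheadGraph γ (G.src u)).verts := ⟨⟨u, rfl⟩, mem_support_turnGraph hus⟩
  obtain ⟨y, hy, hxy⟩ := exists_whiteheadGraph_reachable p x rfl
  classical
  obtain ⟨z, hz, hxz⟩ := exists_whiteheadGraph_reachable (p.takeUntil w (hw p)) x rfl
  let C := (G.whiteheadGraph γ (G.src u)).coe.connectedComponentMk x
  have hyC : y ∈ C.supp := SimpleGraph.ConnectedComponent.sound hxy.symm
  have hzC : z ∈ C.supp := SimpleGraph.ConnectedComponent.sound hxz.symm
  refine ⟨G.src u, C, ⟨z, hzC⟩, ⟨x, rfl⟩, ⟨y, hyC⟩, ?_, ?_, fun q => ?_⟩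
  · intro hh
    have : x = z := congrArg Subtype.val hh
    exact hu (by rw [← hz, ← this])
  · intro hh
    have : y = z := congrArg Subtype.val hh
    exact hv (by rw [← hz, ← this, hy])
  -- A walk in the component projects to a walk in the turn graph, which must pass through `w`; the
  -- only direction of the component lying over `w` is `z`.
  · let f : C.toSimpleGraph →g G.turnGraph fun i => (γ i).edges :=
      { toFun := fun a => a.1.1.1
        map_rel' := fun hab => turnGraph_adj_of_whiteheadGraph hab }
    have hwq := hw ((q.map f).copy rfl hy)
    rw [SimpleGraph.Walk.support_copy, SimpleGraph.Walk.support_map] at hwq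
    obtain ⟨a, ha, haw⟩ := List.mem_map.1 hwq
    have : a = ⟨z, hzC⟩ := Subtype.ext (Subtype.ext (Subtype.ext (haw.trans hz.symm)))
    exact this ▸ ha

end Whitehead

end SerreGraph

namespace SerreGraph

/-! ### Edge paths in the realization -/

section Realization

variable {G : SerreGraph}

theorem continuous_of_charMap {Y : Type*} [TopologicalSpace Y] {f : G.Realization → Y}
    (h : ∀ e, Continuous fun t => f (G.charMap e t)) : Continuous f :=
  continuous_iSup_dom.2 fun e => continuous_coinduced_dom.2 (h e)

theorem isOpen_realization_iff {U : Set G.Realization} :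
    IsOpen U ↔ ∀ e, IsOpen (G.charMap e ⁻¹' U) := by
  simp only [isOpen_iSup_iff, isOpen_coinduced]

theorem charMap_flip (e : G.E) (t : I) :
    G.charMap e t = G.charMap (G.rev e) (unitInterval.symm t) :=
  Quot.sound (Glue.flip e t)

theorem charMap_rev (e : G.E) (t : I) :
    G.charMap (G.rev e) t = G.charMap e (unitInterval.symm t) := by
  rw [charMap_flip e, unitInterval.symm_symm]

open Path

/-- The homotopy class `q` is represented by the edge path `l`. -/
def IsEdgeClass {u w : G.V} (q : Homotopic.Quotient (G.vertexPt u) (G.vertexPt w))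
    (l : List G.E) : Prop :=
  ∃ h : G.IsEdgePath u l w, q = Homotopic.Quotient.mk (G.realizePath u l w h)

theorem isEdgeClass_realizePath {u w : G.V} {l : List G.E} (h : G.IsEdgePath u l w) :
    IsEdgeClass (Homotopic.Quotient.mk (G.realizePath u l w h)) l := ⟨h, rfl⟩

theorem isEdgeClass_nil (u : G.V) : IsEdgeClass (Homotopic.Quotient.refl (G.vertexPt u)) [] :=
  ⟨rfl, rfl⟩

theorem isEdgeClass_cons {e : G.E} {w : G.V}
    {q : Homotopic.Quotient (G.vertexPt (G.tgt e)) (G.vertexPt w)} {l : List G.E} (h : IsEdgeClass q l) :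
    IsEdgeClass ((Homotopic.Quotient.mk (G.edgePath e)).trans q) (e :: l) := by
  obtain ⟨h, rfl⟩ := h
  exact ⟨⟨rfl, h⟩, rfl⟩

theorem isEdgeClass_cons_iff {e : G.E} {w : G.V}
    {q : Homotopic.Quotient (G.vertexPt (G.src e)) (G.vertexPt w)} {l : List G.E} :
    IsEdgeClass q (e :: l) ↔ ∃ q', IsEdgeClass q' l ∧
      q = (Homotopic.Quotient.mk (G.edgePath e)).trans q' := by
  constructor
  · rintro ⟨h, rfl⟩
    exact ⟨_, isEdgeClass_realizePath h.2, rfl⟩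
  · rintro ⟨q', h, rfl⟩
    exact isEdgeClass_cons h

theorem isEdgeClass_edgePath (e : G.E) : IsEdgeClass (Homotopic.Quotient.mk (G.edgePath e)) [e] := by
  simpa using isEdgeClass_cons (isEdgeClass_nil (G.tgt e))

theorem IsEdgeClass.eq {u w : G.V} {q q' : Homotopic.Quotient (G.vertexPt u) (G.vertexPt w)}
    {l : List G.E} (h : IsEdgeClass q l) (h' : IsEdgeClass q' l) : q = q' := by
  obtain ⟨h, rfl⟩ := h
  obtain ⟨h', rfl⟩ := h'
  rfl

theorem IsEdgeClass.isEdgePath {u w : G.V} {q : Homotopic.Quotient (G.vertexPt u) (G.vertexPt w)}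
    {l : List G.E} (h : IsEdgeClass q l) : G.IsEdgePath u l w := h.1

theorem IsEdgeClass.trans {u v w : G.V} {q : Homotopic.Quotient (G.vertexPt u) (G.vertexPt v)}
    {q' : Homotopic.Quotient (G.vertexPt v) (G.vertexPt w)} {l l' : List G.E} (h : IsEdgeClass q l)
    (h' : IsEdgeClass q' l') : IsEdgeClass (q.trans q') (l ++ l') := by
  induction l generalizing u with
  | nil =>
    obtain ⟨h0, h1⟩ := h
    cases h0
    rw [h1]
    show IsEdgeClass ((Homotopic.Quotient.refl _).trans q') l'
    rwa [Homotopic.Quotient.refl_trans]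
  | cons e l ih =>
    obtain rfl := h.isEdgePath.1
    obtain ⟨q'', hq'', rfl⟩ := isEdgeClass_cons_iff.1 h
    rw [Homotopic.Quotient.trans_assoc]
    exact isEdgeClass_cons (ih hq'')

theorem IsEdgeClass.symm {u w : G.V} {q : Homotopic.Quotient (G.vertexPt u) (G.vertexPt w)}
    {l : List G.E} (h : IsEdgeClass q l) : IsEdgeClass q.symm (reversePath l) := by
  induction l generalizing u with
  | nil =>
    obtain ⟨h0, h1⟩ := h
    cases h0
    rw [h1]
    refine ⟨rfl, ?_⟩
    show Homotopic.Quotient.mk (Path.refl _).symm = Homotopic.Quotient.mk (Path.refl _)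
    rw [Path.refl_symm]
  | cons e l ih =>
    obtain rfl := h.isEdgePath.1
    obtain ⟨q', hq', rfl⟩ := isEdgeClass_cons_iff.1 h
    have he : IsEdgeClass (Homotopic.Quotient.mk (G.edgePath e)).symm [G.rev e] := by
      refine ⟨⟨rfl, tgt_rev e⟩, ?_⟩
      -- The equality of `tgt (rev e)` with `src e` is not definitional, so the endpoint is first
      -- made a variable.
      have key : ∀ (v : G.V) (hv : G.tgt (G.rev e) = v),
          Homotopic.Quotient.mk (G.realizePath (G.tgt e) [G.rev e] v ⟨rfl, hv⟩) =
            Homotopic.Quotient.mk ((G.edgePath (G.rev e)).cast rfl (congrArg G.vertexPt hv.symm)) := by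
        rintro v rfl
        obtain ⟨h₁, h₂⟩ := isEdgeClass_edgePath (G.rev e)
        exact h₂.symm
      rw [key _ (tgt_rev e), ← Homotopic.Quotient.mk_symm]
      congr 1
      ext t
      exact (charMap_rev e t).symm
    have hsymm : ((Homotopic.Quotient.mk (G.edgePath e)).trans q').symm =
        q'.symm.trans (Homotopic.Quotient.mk (G.edgePath e)).symm := by
      induction q' using Homotopic.Quotient.ind with | mk p =>
      rw [← Homotopic.Quotient.mk_trans, ← Homotopic.Quotient.mk_symm, ← Homotopic.Quotient.mk_symm,
        ← Homotopic.Quotient.mk_symm, ← Homotopic.Quotient.mk_trans, Path.trans_symm]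
    rw [hsymm, reversePath_cons]
    exact (ih hq').trans he

/-- Each edge path is homotopic to a reduced edge path. -/
theorem IsEdgeClass.exists_isReducedPath {u w : G.V}
    {q : Homotopic.Quotient (G.vertexPt u) (G.vertexPt w)} {l : List G.E} (h : IsEdgeClass q l) :
    ∃ l', G.IsReducedPath l' ∧ IsEdgeClass q l' ∧ G.pathClass l = G.pathClass l' := by
  obtain ⟨l', -, hr, hl'⟩ := SerreGraph.exists_isReducedPath
    (fun u w l l' => G.pathClass l = G.pathClass l' ∧
      ∀ q : Homotopic.Quotient (G.vertexPt u) (G.vertexPt w), IsEdgeClass q l → IsEdgeClass q l')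
    (fun _ => ⟨rfl, fun _ h => h⟩)
    (fun e w l l' _ _ h => ⟨by rw [pathClass_cons, pathClass_cons, h.1], fun q hq => by
      obtain ⟨q', hq', rfl⟩ := isEdgeClass_cons_iff.1 hq
      exact isEdgeClass_cons (h.2 q' hq')⟩)
    (fun e w l l' hp h => ⟨by rw [h.1]; simp [edgeClass_rev], fun q hq => by
      have h1 := h.2 q hq
      have he := isEdgeClass_edgePath e
      have h2 := (he.trans he.symm).trans (isEdgeClass_realizePath hp)
      rw [h1.eq h2, Homotopic.Quotient.trans_symm, Homotopic.Quotient.refl_trans]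
      exact isEdgeClass_realizePath hp⟩) h.isEdgePath
  exact ⟨l', hr, hl'.2 q h, hl'.1⟩

/-- Edge paths of the same class are homotopic. -/
theorem IsEdgeClass.congr {u w : G.V} {q q' : Homotopic.Quotient (G.vertexPt u) (G.vertexPt w)}
    {l l' : List G.E} (h : IsEdgeClass q l) (h' : IsEdgeClass q' l')
    (hc : G.pathClass l = G.pathClass l') : q = q' := by
  obtain ⟨m, hm, hq, hmc⟩ := h.exists_isReducedPath
  obtain ⟨m', hm', hq', hmc'⟩ := h'.exists_isReducedPath
  obtain rfl := hm.eq_of_pathClass_eq hm' (by rw [← hmc, ← hmc', hc])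
  exact hq.eq hq'

end Realization

end SerreGraph

/-- The two ways around the boundary of a square are homotopic. -/
theorem Path.Homotopic.of_square {X : Type*} [TopologicalSpace X] (K : C(I × I, X)) {a b c d : X}
    (p : Path a b) (q : Path b d) (p' : Path a c) (q' : Path c d) (hp : ∀ t, p t = K (0, t))
    (hq : ∀ t, q t = K (t, 1)) (hp' : ∀ t, p' t = K (t, 0)) (hq' : ∀ t, q' t = K (1, t)) :
    (p.trans q).Homotopic (p'.trans q') := by
  obtain rfl : a = K (0, 0) := by rw [← hp, p.source]
  obtain rfl : b = K (0, 1) := by rw [← hp, p.target]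
  obtain rfl : c = K (1, 0) := by rw [← hp', p'.target]
  obtain rfl : d = K (1, 1) := by rw [← hq, q.target]
  let f : C(I, X) := K.comp ((ContinuousMap.const I 0).prodMk (ContinuousMap.id I))
  let g : C(I, X) := K.comp ((ContinuousMap.const I 1).prodMk (ContinuousMap.id I))
  let F : f.Homotopy g := ⟨K, fun _ => rfl, fun _ => rfl⟩
  let γ : Path (0 : I) 1 := ⟨ContinuousMap.id I, rfl, rfl⟩
  have h := Path.Homotopic.map_trans_evalAt F γ
  have e1 : p = γ.map (map_continuous f) := Path.ext (funext hp)
  have e2 : q = F.evalAt 1 := Path.ext (funext hq)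
  have e3 : p' = F.evalAt 0 := Path.ext (funext hp')
  have e4 : q' = γ.map (map_continuous g) := Path.ext (funext hq')
  rw [e1, e2, e3, e4]
  exact h

namespace SerreGraph

/-! ### Every path between vertices is homotopic to an edge path -/

section Approximation

variable {G : SerreGraph}

open Path

variable (G) in
/-- The initial vertex of the edge that carries a representative of a point. -/
def repStart : G.V ⊕ (G.E × I) → G.V
  | Sum.inl v => v
  | Sum.inr (e, _) => G.src e

variable (G) in
/-- The point of the realization with a given representative. -/
def repPt (r : G.V ⊕ (G.E × I)) : G.Realization := Quot.mk G.Glue r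

variable (G) in
/-- The straight path from the initial vertex of an edge to a point of this edge. -/
def straightFun : G.V ⊕ (G.E × I) → I → G.Realization
  | Sum.inl v, _ => G.vertexPt v
  | Sum.inr (e, t), τ => G.charMap e (τ * t)

variable (G) in
/-- The straight path to a represented point. -/
def straightPath (r : G.V ⊕ (G.E × I)) :
    Path (G.vertexPt (G.repStart r)) (G.repPt r) where
  toFun := G.straightFun r
  continuous_toFun := by
    rcases r with v | ⟨e, t⟩
    · exact continuous_const
    · exact (G.continuous_charMap e).comp (by fun_prop)
  source' := by
    rcases r with v | ⟨e, t⟩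
    · rfl
    · show G.charMap e (0 * t) = _
      rw [zero_mul, charMap_zero]; rfl
  target' := by
    rcases r with v | ⟨e, t⟩
    · rfl
    · show G.charMap e (1 * t) = _
      rw [one_mul]; rfl

/-- A path from a vertex that is the straight path given by a representative of its endpoint. -/
def IsStraight {w : G.V} {x : G.Realization} (s : Path (G.vertexPt w) x) : Prop :=
  ∃ r, G.repPt r = x ∧ G.repStart r = w ∧ ∀ τ, s τ = G.straightFun r τ

/-- Both sides come from paths in the contractible interval: from `0` directly to `t`, or from `0`
to `1` and back to `t`. The characteristic map of `e` carries one homotopy to the other side. -/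
theorem straight_flip (e : G.E) (t : I) {x : G.Realization} (s : Path (G.vertexPt (G.src e)) x)
    (s' : Path (G.vertexPt (G.tgt e)) x) (hs : ∀ τ, s τ = G.charMap e (τ * t))
    (hs' : ∀ τ, s' τ = G.charMap (G.rev e) (τ * unitInterval.symm t)) :
    s.Homotopic ((G.edgePath e).trans s') := by
  let p : Path (0 : I) t := ⟨⟨fun τ => τ * t, by fun_prop⟩, by simp, by simp⟩
  let p₁ : Path (0 : I) 1 := ⟨ContinuousMap.id I, rfl, rfl⟩
  let p₂ : Path (1 : I) t :=
    ⟨⟨fun τ => unitInterval.symm (τ * unitInterval.symm t), by fun_prop⟩, by simp, by simp⟩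
  have : ContractibleSpace I := (convex_Icc (0 : ℝ) 1).contractibleSpace ⟨0, by simp⟩
  have h : p.Homotopic (p₁.trans p₂) := SimplyConnectedSpace.paths_homotopic _ _
  have hx : x = G.charMap e t := by rw [← s.target, hs, one_mul]
  have h' := (h.map ⟨G.charMap e, G.continuous_charMap e⟩).pathCast
    (G.charMap_zero e).symm hx
  convert h' using 1
  · ext τ
    exact hs τ
  · ext τ
    simp only [Path.trans_apply, Path.cast_coe, Path.map_coe, Function.comp_apply,
      ContinuousMap.coe_mk]
    split_ifs
    · rfl
    · rw [hs', charMap_rev]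
      rfl

theorem exists_isEdgeClass_of_apply_eq {w : G.V} {x : G.Realization}
    (s s' : Path (G.vertexPt w) x) (h : ∀ τ, s τ = s' τ) : ∃ q l, IsEdgeClass q l ∧
      Homotopic.Quotient.mk s = Homotopic.Quotient.trans q (Homotopic.Quotient.mk s') :=
  ⟨_, _, isEdgeClass_nil _, by rw [Homotopic.Quotient.refl_trans, Path.ext (funext h)]⟩

/-- Two straight paths to the same point differ by an edge path. -/
theorem exists_isEdgeClass_of_eqvGen {r r' : G.V ⊕ (G.E × I)} (h : Relation.EqvGen G.Glue r r') :
    ∀ {x : G.Realization} {w w' : G.V} (s : Path (G.vertexPt w) x) (s' : Path (G.vertexPt w') x),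
      G.repStart r = w → G.repStart r' = w' → (∀ τ, s τ = G.straightFun r τ) →
      (∀ τ, s' τ = G.straightFun r' τ) → ∃ q l, IsEdgeClass q l ∧
        Homotopic.Quotient.mk s = Homotopic.Quotient.trans q (Homotopic.Quotient.mk s') := by
  induction h with
  | rel r r' h =>
    rintro x w w' s s' rfl rfl hs hs'
    cases h with
    | start e =>
      refine exists_isEdgeClass_of_apply_eq (w := G.src e) s s' fun τ =>
        (hs τ).trans (Eq.trans ?_ (hs' τ).symm)
      show G.charMap e (τ * 0) = G.vertexPt (G.src e)
      rw [mul_zero, charMap_zero]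
    | flip e t =>
      exact ⟨_, _, isEdgeClass_edgePath e,
        Homotopic.Quotient.eq.2 (straight_flip e t s s' hs hs')⟩
  | refl r =>
    rintro x w w' s s' rfl rfl hs hs'
    exact exists_isEdgeClass_of_apply_eq s s' fun τ => by rw [hs, hs']
  | symm r r' _ ih =>
    intro x w w' s s' hw hw' hs hs'
    obtain ⟨q, l, hq, h⟩ := ih s' s hw' hw hs' hs
    refine ⟨_, _, hq.symm, ?_⟩
    rw [h, ← Homotopic.Quotient.trans_assoc, Homotopic.Quotient.symm_trans,
      Homotopic.Quotient.refl_trans]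
  | trans r r' r'' h₁ _ ih₁ ih₂ =>
    intro x w w' s s' hw hw' hs hs'
    have hx : G.repPt r' = x := by
      rw [repPt, ← Quot.eqvGen_sound h₁, ← s.target, hs]
      exact (G.straightPath r).target.symm
    subst hx
    -- The straight path of the intermediate representative links the two comparisons.
    obtain ⟨q, l, hq, h⟩ := ih₁ s (G.straightPath r') hw rfl hs fun _ => rfl
    obtain ⟨q', l', hq', h'⟩ := ih₂ (G.straightPath r') s' rfl hw' (fun _ => rfl) hs'
    refine ⟨_, _, hq.trans hq', ?_⟩
    rw [h, h', Homotopic.Quotient.trans_assoc]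

theorem IsStraight.exists_isEdgeClass {x : G.Realization} {w w' : G.V} {s : Path (G.vertexPt w) x}
    {s' : Path (G.vertexPt w') x} (h : IsStraight s) (h' : IsStraight s') :
    ∃ q l, IsEdgeClass q l ∧
      Homotopic.Quotient.mk s = Homotopic.Quotient.trans q (Homotopic.Quotient.mk s') := by
  obtain ⟨r, hr, hw, hs⟩ := h
  obtain ⟨r', hr', hw', hs'⟩ := h'
  exact exists_isEdgeClass_of_eqvGen (Quot.eqvGen_exact (hr.trans hr'.symm)) s s' hw hw' hs hs'

/-- A homotopy class that consists of an edge path followed by a straight path. -/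
def IsAlmostEdge {u : G.V} {x : G.Realization} (q : Homotopic.Quotient (G.vertexPt u) x) : Prop :=
  ∃ (w : G.V) (s : Path (G.vertexPt w) x) (q₀ : Homotopic.Quotient (G.vertexPt u) (G.vertexPt w))
    (l : List G.E), IsStraight s ∧ IsEdgeClass q₀ l ∧ q = q₀.trans (Homotopic.Quotient.mk s)

/-- An open set with a continuous family of straight paths from `w` to its points. -/
structure IsStraightChart (U : Set G.Realization) (w : G.V)
    (D : G.Realization → C(I, G.Realization)) : Prop where
  isOpen : IsOpen U
  continuousOn : ContinuousOn D U
  straight : ∀ x ∈ U, ∃ r, G.repPt r = x ∧ G.repStart r = w ∧ ∀ τ, D x τ = G.straightFun r τ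

namespace IsStraightChart

variable {U : Set G.Realization} {w : G.V} {D : G.Realization → C(I, G.Realization)}

theorem exists_path (h : IsStraightChart U w D) {x : G.Realization} (hx : x ∈ U) :
    ∃ s : Path (G.vertexPt w) x, IsStraight s ∧ ∀ τ, s τ = D x τ := by
  obtain ⟨r, rfl, rfl, hr⟩ := h.straight x hx
  exact ⟨G.straightPath r, ⟨r, rfl, rfl, fun _ => rfl⟩, fun τ => (hr τ).symm⟩

/-- As a point moves along `r`, its straight path from `w` sweeps out a square whose sides are the
straight paths to `x` and `y`, the path `r`, and a constant path at `w`. Hence the straight path to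
`x` followed by `r` is homotopic to the straight path to `y`, and the straight path already present
differs from the one to `x` by an edge path. -/
theorem isAlmostEdge (h : IsStraightChart U w D) {u : G.V} {x y : G.Realization}
    {q : Homotopic.Quotient (G.vertexPt u) x} (hq : IsAlmostEdge q) (r : Path x y)
    (hr : ∀ τ, r τ ∈ U) : IsAlmostEdge (q.trans (Homotopic.Quotient.mk r)) := by
  obtain ⟨w', s, q₀, l, hs, hq₀, rfl⟩ := hq
  obtain ⟨sx, hsx, hDx⟩ := h.exists_path (by simpa using hr 0)
  obtain ⟨sy, hsy, hDy⟩ := h.exists_path (by simpa using hr 1)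
  obtain ⟨q₁, l₁, hq₁, hs₁⟩ := hs.exists_isEdgeClass hsx
  refine ⟨w, sy, _, _, hsy, hq₀.trans hq₁, ?_⟩
  rw [hs₁, Homotopic.Quotient.trans_assoc, Homotopic.Quotient.trans_assoc,
    Homotopic.Quotient.trans_assoc]
  congr 2
  have hc : Continuous fun τ => D (r τ) :=
    h.continuousOn.comp_continuous r.continuous hr
  let K : C(I × I, G.Realization) := ContinuousMap.uncurry ⟨fun τ => D (r τ), hc⟩
  have hK : ∀ τ τ', K (τ, τ') = D (r τ) τ' := fun _ _ => rfl
  have hsq := Path.Homotopic.of_square K sx r (Path.refl _) sy (fun t => ?_) (fun t => ?_)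
    (fun t => ?_) (fun t => ?_)
  · rw [← Homotopic.Quotient.mk_trans, Homotopic.Quotient.eq]
    refine hsq.trans ?_
    exact Path.Homotopic.refl_trans _
  · rw [hK, hDx, r.source]
  · obtain ⟨s', -, hs'⟩ := h.exists_path (hr t)
    rw [hK, ← hs', s'.target]
  · obtain ⟨s', -, hs'⟩ := h.exists_path (hr t)
    rw [hK, ← hs', s'.source]
    rfl
  · rw [hK, hDy, r.target]

end IsStraightChart

/-! The charts: open stars of vertices and open edges. -/

variable (G) in
/-- The family of straight paths along an edge. -/
noncomputable def straightFamily (e : G.E) : C(I, C(I, G.Realization)) :=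
  ContinuousMap.curry ⟨fun p => G.charMap e (p.2 * p.1), (G.continuous_charMap e).comp (by fun_prop)⟩

theorem straightFamily_apply (e : G.E) (t τ : I) :
    G.straightFamily e t τ = G.charMap e (τ * t) := rfl

variable (G) in
open Classical in
/-- Straight paths from the nearest vertex. -/
noncomputable def starMap : G.Realization → C(I, G.Realization) :=
  Quot.lift (fun r => match r with
    | Sum.inl v => ContinuousMap.const I (G.vertexPt v)
    -- Midpoints have no nearest vertex. They lie in no star, so any value compatible with the flip
    -- of the edge will do.
    | Sum.inr (e, t) => if (t : ℝ) < 1 / 2 then G.straightFamily e t else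
        if 1 / 2 < (t : ℝ) then G.straightFamily (G.rev e) (unitInterval.symm t) else
          ContinuousMap.const I (G.charMap e t)) (by
    intro r r' h
    cases h with
    | start e =>
      have h0 : ((0 : I) : ℝ) < 1 / 2 := by norm_num
      simp only [if_pos h0]
      ext τ
      rw [straightFamily_apply, mul_zero, charMap_zero]
      rfl
    | flip e t =>
      have h1 : (unitInterval.symm t : ℝ) = 1 - t := rfl
      simp only [h1]
      rcases lt_trichotomy (t : ℝ) (1 / 2) with ht | ht | ht
      · rw [if_pos ht, if_neg (by linarith), if_pos (by linarith), rev_rev,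
          unitInterval.symm_symm]
      · rw [if_neg (by linarith), if_neg (by linarith), if_neg (by linarith),
          if_neg (by linarith), charMap_flip]
      · rw [if_neg (by linarith), if_pos ht, if_pos (by linarith)])

variable (G) in
/-- The open star of a vertex. -/
def star (v : G.V) : Set G.Realization := {x | Quot.lift (fun r => match r with
    | Sum.inl w => w = v
    | Sum.inr (e, t) => ((t : ℝ) < 1 / 2 ∧ G.src e = v) ∨ (1 / 2 < (t : ℝ) ∧ G.tgt e = v)) (by
    intro r r' h
    cases h with
    | start e => simp
    | flip e t =>
      have h1 : (unitInterval.symm t : ℝ) = 1 - t := rfl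
      simp only [h1, src_rev, tgt_rev, eq_iff_iff]
      constructor
      · rintro (h | h)
        · exact Or.inr ⟨by linarith [h.1], h.2⟩
        · exact Or.inl ⟨by linarith [h.1], h.2⟩
      · rintro (h | h)
        · exact Or.inr ⟨by linarith [h.1], h.2⟩
        · exact Or.inl ⟨by linarith [h.1], h.2⟩) x}

theorem charMap_mem_star {v : G.V} {e : G.E} {t : I} : G.charMap e t ∈ G.star v ↔
    ((t : ℝ) < 1 / 2 ∧ G.src e = v) ∨ (1 / 2 < (t : ℝ) ∧ G.tgt e = v) := Iff.rfl

theorem starMap_of_lt (e : G.E) {t : I} (h : (t : ℝ) < 1 / 2) :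
    G.starMap (G.charMap e t) = G.straightFamily e t := if_pos h

theorem starMap_of_gt (e : G.E) {t : I} (h : 1 / 2 < (t : ℝ)) :
    G.starMap (G.charMap e t) = G.straightFamily (G.rev e) (unitInterval.symm t) :=
  (if_neg (by linarith)).trans (if_pos h)

/-- Cutting edges at their midpoints keeps the two ends of a loop edge apart. On each half edge the
straight paths depend continuously on the parameter, which suffices for the CW topology. -/
theorem isStraightChart_star (v : G.V) : IsStraightChart (G.star v) v G.starMap := by
  have ho : IsOpen (G.star v) := by
    rw [isOpen_realization_iff]
    intro e
    refine IsOpen.union (IsOpen.and ?_ isOpen_const) (IsOpen.and ?_ isOpen_const)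
    · exact isOpen_lt (by fun_prop) (by fun_prop)
    · exact isOpen_lt (by fun_prop) (by fun_prop)
  refine ⟨ho, (continuousOn_open_iff ho).2 fun W hW => isOpen_realization_iff.2 fun e => ?_, ?_⟩
  · have : G.charMap e ⁻¹' (G.star v ∩ G.starMap ⁻¹' W) =
        {t : I | ((t : ℝ) < 1 / 2 ∧ G.src e = v) ∧ G.straightFamily e t ∈ W} ∪
        {t : I | (1 / 2 < (t : ℝ) ∧ G.tgt e = v) ∧
          G.straightFamily (G.rev e) (unitInterval.symm t) ∈ W} := by
      ext t
      simp only [Set.mem_preimage, Set.mem_inter_iff, charMap_mem_star, or_and_right,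
        Set.mem_union, Set.mem_ofPred_eq]
      refine or_congr (and_congr_right fun h => ?_) (and_congr_right fun h => ?_)
      · rw [starMap_of_lt e h.1]
      · rw [starMap_of_gt e h.1]
    rw [this]
    refine IsOpen.union (IsOpen.and (IsOpen.and ?_ isOpen_const) ?_)
      (IsOpen.and (IsOpen.and ?_ isOpen_const) ?_)
    · exact isOpen_lt (by fun_prop) (by fun_prop)
    · exact hW.preimage (map_continuous _)
    · exact isOpen_lt (by fun_prop) (by fun_prop)
    · exact hW.preimage ((map_continuous (G.straightFamily (G.rev e))).comp
        unitInterval.continuous_symm)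
  · rintro ⟨w | ⟨e, t⟩⟩ hx
    · exact ⟨Sum.inl w, rfl, hx, fun τ => rfl⟩
    · rcases hx with h | h
      · exact ⟨Sum.inr (e, t), rfl, h.2, fun τ => congrArg (fun f => f τ) (starMap_of_lt e h.1)⟩
      · exact ⟨Sum.inr (G.rev e, unitInterval.symm t), (Quot.sound (Glue.flip e t)).symm, h.2,
          fun τ => congrArg (fun f => f τ) (starMap_of_gt e h.1)⟩

variable (G) in
open Classical in
/-- Straight paths from the beginning of an edge to its interior points. -/
noncomputable def edgeMap (e₀ : G.E) : G.Realization → C(I, G.Realization) :=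
  Quot.lift (fun r => match r with
    | Sum.inl v => ContinuousMap.const I (G.vertexPt v)
    | Sum.inr (e, t) => if (0 < (t : ℝ) ∧ (t : ℝ) < 1) ∧ e = e₀ then G.straightFamily e₀ t else
        if (0 < (t : ℝ) ∧ (t : ℝ) < 1) ∧ e = G.rev e₀ then
          G.straightFamily e₀ (unitInterval.symm t) else
          ContinuousMap.const I (G.charMap e t)) (by
    intro r r' h
    cases h with
    | start e => simp [charMap_zero]
    | flip e t =>
      have h1 : (unitInterval.symm t : ℝ) = 1 - t := rfl
      have h2 : G.rev e = e₀ ↔ e = G.rev e₀ :=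
        ⟨fun h => by rw [← h, rev_rev], fun h => by rw [h, rev_rev]⟩
      have h3 : (0 < 1 - (t : ℝ) ∧ 1 - (t : ℝ) < 1) ↔ (0 < (t : ℝ) ∧ (t : ℝ) < 1) :=
        ⟨fun h => ⟨by linarith, by linarith⟩, fun h => ⟨by linarith, by linarith⟩⟩
      simp only [h1, h2, h3, rev_injective.eq_iff, unitInterval.symm_symm]
      by_cases ha : e = e₀
      · have hb : e ≠ G.rev e₀ := by rw [ha]; exact (G.rev_ne e₀).symm
        simp only [ha, (G.rev_ne e₀).symm, and_true, and_false, if_false]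
        rw [charMap_flip]
      · simp only [ha, and_false, if_false]
        rw [charMap_flip])

variable (G) in
/-- The interior of an edge. -/
def openEdge (e₀ : G.E) : Set G.Realization := {x | Quot.lift (fun r => match r with
    | Sum.inl _ => False
    | Sum.inr (e, t) => (0 < (t : ℝ) ∧ (t : ℝ) < 1) ∧ (e = e₀ ∨ e = G.rev e₀)) (by
    intro r r' h
    cases h with
    | start e => simp
    | flip e t =>
      have h1 : (unitInterval.symm t : ℝ) = 1 - t := rfl
      have h2 : G.rev e = e₀ ↔ e = G.rev e₀ :=
        ⟨fun h => by rw [← h, rev_rev], fun h => by rw [h, rev_rev]⟩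
      have h3 : (0 < 1 - (t : ℝ) ∧ 1 - (t : ℝ) < 1) ↔ (0 < (t : ℝ) ∧ (t : ℝ) < 1) :=
        ⟨fun h => ⟨by linarith, by linarith⟩, fun h => ⟨by linarith, by linarith⟩⟩
      simp only [h1, h2, h3, rev_injective.eq_iff, or_comm]) x}

theorem charMap_mem_openEdge {e₀ e : G.E} {t : I} : G.charMap e t ∈ G.openEdge e₀ ↔
    (0 < (t : ℝ) ∧ (t : ℝ) < 1) ∧ (e = e₀ ∨ e = G.rev e₀) := Iff.rfl

theorem edgeMap_self (e : G.E) {t : I} (h : 0 < (t : ℝ) ∧ (t : ℝ) < 1) :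
    G.edgeMap e (G.charMap e t) = G.straightFamily e t := if_pos ⟨h, rfl⟩

theorem edgeMap_rev (e : G.E) {t : I} (h : 0 < (t : ℝ) ∧ (t : ℝ) < 1) :
    G.edgeMap e (G.charMap (G.rev e) t) = G.straightFamily e (unitInterval.symm t) :=
  (if_neg fun hh => G.rev_ne e hh.2).trans (if_pos ⟨h, rfl⟩)

theorem isStraightChart_openEdge (e₀ : G.E) :
    IsStraightChart (G.openEdge e₀) (G.src e₀) (G.edgeMap e₀) := by
  have hI : IsOpen {t : I | 0 < (t : ℝ) ∧ (t : ℝ) < 1} :=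
    IsOpen.and (isOpen_lt (by fun_prop) (by fun_prop)) (isOpen_lt (by fun_prop) (by fun_prop))
  have ho : IsOpen (G.openEdge e₀) := by
    rw [isOpen_realization_iff]
    exact fun e => IsOpen.and hI isOpen_const
  refine ⟨ho, (continuousOn_open_iff ho).2 fun W hW => isOpen_realization_iff.2 fun e => ?_, ?_⟩
  · by_cases h : e = e₀
    · subst h
      have : G.charMap e ⁻¹' (G.openEdge e ∩ G.edgeMap e ⁻¹' W) =
          {t : I | (0 < (t : ℝ) ∧ (t : ℝ) < 1) ∧ G.straightFamily e t ∈ W} := by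
        ext t
        simp only [Set.mem_preimage, Set.mem_inter_iff, charMap_mem_openEdge, true_or, and_true,
          Set.mem_ofPred_eq]
        exact and_congr_right fun h => by rw [edgeMap_self e h]
      rw [this]
      exact IsOpen.and hI (hW.preimage (map_continuous _))
    · by_cases h' : e = G.rev e₀
      · subst h'
        have : G.charMap (G.rev e₀) ⁻¹' (G.openEdge e₀ ∩ G.edgeMap e₀ ⁻¹' W) =
            {t : I | (0 < (t : ℝ) ∧ (t : ℝ) < 1) ∧
              G.straightFamily e₀ (unitInterval.symm t) ∈ W} := by
          ext t
          simp only [Set.mem_preimage, Set.mem_inter_iff, charMap_mem_openEdge, or_true, and_true,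
            Set.mem_ofPred_eq]
          exact and_congr_right fun h => by rw [edgeMap_rev e₀ h]
        rw [this]
        exact IsOpen.and hI (hW.preimage ((map_continuous (G.straightFamily e₀)).comp
          unitInterval.continuous_symm))
      · convert isOpen_empty
        ext t
        simp [charMap_mem_openEdge, h, h']
  · rintro ⟨w | ⟨e, t⟩⟩ hx
    · exact hx.elim
    · obtain ⟨ht, rfl | rfl⟩ := hx
      · exact ⟨Sum.inr (e, t), rfl, rfl, fun τ => congrArg (fun f => f τ) (edgeMap_self e ht)⟩
      · refine ⟨Sum.inr (e₀, unitInterval.symm t), ?_, rfl,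
          fun τ => congrArg (fun f => f τ) (edgeMap_rev e₀ ht)⟩
        exact (charMap_rev e₀ t).symm

theorem exists_isStraightChart (x : G.Realization) : ∃ U w D, IsStraightChart (G := G) U w D ∧ x ∈ U := by
  obtain ⟨v | ⟨e, t⟩⟩ := x
  · exact ⟨_, _, _, isStraightChart_star v, rfl⟩
  · by_cases ht : 0 < (t : ℝ) ∧ (t : ℝ) < 1
    · exact ⟨_, _, _, isStraightChart_openEdge e, ht, Or.inl rfl⟩
    · rcases lt_or_ge (t : ℝ) (1 / 2) with h | h
      · exact ⟨_, _, _, isStraightChart_star (G.src e), Or.inl ⟨h, rfl⟩⟩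
      · refine ⟨_, _, _, isStraightChart_star (G.tgt e), Or.inr ⟨?_, rfl⟩⟩
        have : ¬ (t : ℝ) < 1 := fun h1 => ht ⟨by linarith, h1⟩
        linarith

/-- A path that starts at a vertex is homotopic to an edge path followed by a straight path. -/
theorem isAlmostEdge_mk {u : G.V} {x : G.Realization} (p : Path (G.vertexPt u) x) :
    IsAlmostEdge (Homotopic.Quotient.mk p) := by
  -- `P t` asserts the claim for the restriction of `p` to the interval from `0` to `t`.
  let P : I → Prop := fun t =>
    IsAlmostEdge ((Homotopic.Quotient.mk (p.subpath 0 t)).cast p.source.symm rfl)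
  have hstep : ∀ (U : Set G.Realization) w D, IsStraightChart U w D → ∀ t t' : I,
      (∀ τ ∈ Set.uIcc t t', p τ ∈ U) → P t → P t' := by
    intro U w D hU t t' hp ht
    have h := hU.isAlmostEdge ht (p.subpath t t') fun τ => by
      have : p.subpath t t' τ ∈ Set.range (p.subpath t t') := ⟨τ, rfl⟩
      rw [Path.range_subpath] at this
      obtain ⟨τ', hτ', h⟩ := this
      exact h ▸ hp τ' hτ'
    convert h using 1
    have hh : Homotopic.Quotient.mk (p.subpath 0 t') =
        (Homotopic.Quotient.mk (p.subpath 0 t)).trans (Homotopic.Quotient.mk (p.subpath t t')) :=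
      (Homotopic.Quotient.eq.2 ⟨Path.Homotopy.subpathTransSubpath p 0 t t'⟩).symm
    rw [hh]
    rfl
  -- Within one chart the claim passes both forwards and backwards in `t`, so `P` is locally
  -- constant. Connectedness of the interval then takes the place of a subdivision by a Lebesgue
  -- number.
  have hloc : IsLocallyConstant P := by
    rw [IsLocallyConstant.iff_eventually_eq]
    intro t
    obtain ⟨U, w, D, hU, ht⟩ := exists_isStraightChart (p t)
    obtain ⟨b, c, -, hbc, hsub⟩ := exists_Icc_mem_subset_of_mem_nhds
      ((hU.isOpen.preimage p.continuous).mem_nhds ht)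
    have htm : t ∈ Set.Icc b c := mem_of_mem_nhds hbc
    filter_upwards [hbc] with t' ht'
    refine propext ⟨hstep U w D hU t' t ?_, hstep U w D hU t t' ?_⟩
    · exact fun τ hτ => hsub (Set.uIcc_subset_Icc ht' htm hτ)
    · exact fun τ hτ => hsub (Set.uIcc_subset_Icc htm ht' hτ)
  have h0 : P 0 := by
    refine ⟨u, (Path.refl (G.vertexPt u)).cast rfl p.source, _, _,
      ⟨Sum.inl u, p.source.symm, rfl, fun _ => rfl⟩, isEdgeClass_nil u, ?_⟩
    rw [Homotopic.Quotient.refl_trans, Path.subpath_self, ← Homotopic.Quotient.mk_cast]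
    congr 1
    ext τ
    exact p.source
  have h1 : P 1 := by
    rw [hloc.apply_eq_of_preconnectedSpace 1 0]
    exact h0
  have hcast : ∀ {y : G.Realization} (q : Homotopic.Quotient (G.vertexPt u) y) (h : x = y),
      IsAlmostEdge q → IsAlmostEdge (q.cast rfl h) := by
    rintro y q rfl hq
    rwa [Homotopic.Quotient.cast_rfl_rfl]
  have h2 := hcast _ p.target.symm h1
  rw [Path.subpath_zero_one] at h2
  exact h2

/-- Every path between vertices is homotopic to an edge path. -/
theorem exists_isEdgeClass {u w : G.V} (q : Homotopic.Quotient (G.vertexPt u) (G.vertexPt w)) :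
    ∃ l, IsEdgeClass q l := by
  induction q using Homotopic.Quotient.ind with | mk p =>
  obtain ⟨v, s, q₀, l, hs, hq₀, h⟩ := isAlmostEdge_mk p
  obtain ⟨q₁, l₁, hq₁, h₁⟩ := hs.exists_isEdgeClass (s' := Path.refl (G.vertexPt w))
    ⟨Sum.inl w, rfl, rfl, fun _ => rfl⟩
  rw [Homotopic.Quotient.mk_refl, Homotopic.Quotient.trans_refl] at h₁
  rw [h, h₁]
  exact ⟨_, hq₀.trans hq₁⟩

end Approximation

end SerreGraph

namespace SerreGraph

/-! ### Homotopic edge paths have the same class -/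

namespace Hom

variable {Γ Γ' : SerreGraph}

/-- The map of realizations induced by a morphism of graphs. -/
def realize (f : Γ.Hom Γ') : Γ.Realization → Γ'.Realization :=
  Quot.map (Sum.map f.vert (Prod.map f.edge id)) (by
    rintro _ _ (e | ⟨e, t⟩)
    · show Γ'.Glue (Sum.inr (f.edge e, 0)) (Sum.inl (f.vert (Γ.src e)))
      rw [← f.src_edge]
      exact Glue.start _
    · show Γ'.Glue (Sum.inr (f.edge e, t)) (Sum.inr (f.edge (Γ.rev e), unitInterval.symm t))
      rw [f.rev_edge]
      exact Glue.flip _ _)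

theorem continuous_realize (f : Γ.Hom Γ') : Continuous f.realize :=
  continuous_of_charMap fun e => Γ'.continuous_charMap (f.edge e)

end Hom

section Cover

variable {G : SerreGraph}

open Path

variable (G) in
/-- The covering graph on which the class of an edge path can be read off: its fibres are copies
of the free group on the oriented edges, and crossing an edge multiplies by its class. -/
def cover : SerreGraph where
  V := G.V × FreeGroup G.E
  E := G.E × FreeGroup G.E
  src e := (G.src e.1, e.2)
  rev e := (G.rev e.1, e.2 * G.edgeClass e.1)
  rev_rev e := by simp [rev_rev, edgeClass_rev]
  rev_ne e h := G.rev_ne e.1 (congrArg Prod.fst h)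

variable (G) in
/-- The projection of the covering graph. -/
def coverHom : G.cover.Hom G where
  vert := Prod.fst
  edge := Prod.fst
  src_edge _ := rfl
  rev_edge _ := rfl

variable (G) in
/-- The action on the covering graph by multiplication from the left. -/
def coverSMul (h : FreeGroup G.E) : G.cover.Hom G.cover where
  vert v := (v.1, h * v.2)
  edge e := (e.1, h * e.2)
  src_edge _ := rfl
  rev_edge e := Prod.ext rfl (mul_assoc h e.2 (G.edgeClass e.1)).symm

instance : MulAction (FreeGroup G.E) G.cover.Realization where
  smul h := (G.coverSMul h).realize
  one_smul := by
    rintro ⟨⟨v, g⟩ | ⟨⟨e, g⟩, t⟩⟩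
    · show Quot.mk _ (Sum.inl (v, 1 * g)) = _
      rw [one_mul]; rfl
    · show Quot.mk _ (Sum.inr ((e, 1 * g), t)) = _
      rw [one_mul]; rfl
  mul_smul := by
    rintro h h' ⟨⟨v, g⟩ | ⟨⟨e, g⟩, t⟩⟩
    · show Quot.mk _ (Sum.inl (v, h * h' * g)) = Quot.mk _ (Sum.inl (v, h * (h' * g)))
      rw [mul_assoc]
    · show Quot.mk _ (Sum.inr ((e, h * h' * g), t)) = Quot.mk _ (Sum.inr ((e, h * (h' * g)), t))
      rw [mul_assoc]

variable (G) in
/-- The points of the covering space that are close to a vertex on the sheet `g`. -/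
def vertexSheet (g : FreeGroup G.E) : Set G.cover.Realization :=
  {x | Quot.lift (fun r => match r with
    | Sum.inl v => v.2 = g
    | Sum.inr (e, t) => ((t : ℝ) < 1 / 2 ∧ e.2 = g) ∨
        (1 / 2 < (t : ℝ) ∧ e.2 * G.edgeClass e.1 = g)) (by
    intro r r' h
    cases h with
    | start e => simp [cover]
    | flip e t =>
      have h1 : (unitInterval.symm t : ℝ) = 1 - t := rfl
      simp only [h1, eq_iff_iff, cover, edgeClass_rev, mul_inv_cancel_right]
      constructor
      · rintro (h | h)
        · exact Or.inr ⟨by linarith [h.1], h.2⟩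
        · exact Or.inl ⟨by linarith [h.1], h.2⟩
      · rintro (h | h)
        · exact Or.inr ⟨by linarith [h.1], h.2⟩
        · exact Or.inl ⟨by linarith [h.1], h.2⟩) x}

variable (G) in
/-- The points of the covering space in the interior of an edge that starts on the sheet `g`. -/
def edgeSheet (e₀ : G.E) (g : FreeGroup G.E) : Set G.cover.Realization :=
  {x | Quot.lift (fun r => match r with
    | Sum.inl _ => False
    | Sum.inr (e, t) => (0 < (t : ℝ) ∧ (t : ℝ) < 1) ∧
        ((e.1 = e₀ ∧ e.2 = g) ∨ (G.rev e.1 = e₀ ∧ e.2 * G.edgeClass e.1 = g))) (by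
    intro r r' h
    cases h with
    | start e => simp
    | flip e t =>
      have h1 : (unitInterval.symm t : ℝ) = 1 - t := rfl
      have h3 : (0 < 1 - (t : ℝ) ∧ 1 - (t : ℝ) < 1) ↔ (0 < (t : ℝ) ∧ (t : ℝ) < 1) :=
        ⟨fun h => ⟨by linarith, by linarith⟩, fun h => ⟨by linarith, by linarith⟩⟩
      simp only [h1, h3, eq_iff_iff, cover, edgeClass_rev, mul_inv_cancel_right, rev_rev]
      exact and_congr_right fun _ => or_comm) x}

theorem charMap_mem_vertexSheet {e : G.E} {g g' : FreeGroup G.E} {t : I} :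
    G.cover.charMap (e, g) t ∈ G.vertexSheet g' ↔ ((t : ℝ) < 1 / 2 ∧ g = g') ∨
        (1 / 2 < (t : ℝ) ∧ g * G.edgeClass e = g') := Iff.rfl

theorem charMap_mem_edgeSheet {e₀ e : G.E} {g g' : FreeGroup G.E} {t : I} :
    G.cover.charMap (e, g) t ∈ G.edgeSheet e₀ g' ↔ (0 < (t : ℝ) ∧ (t : ℝ) < 1) ∧
        ((e = e₀ ∧ g = g') ∨ (G.rev e = e₀ ∧ g * G.edgeClass e = g')) := Iff.rfl

theorem isOpen_vertexSheet (g : FreeGroup G.E) : IsOpen (G.vertexSheet g) := by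
  rw [isOpen_realization_iff]
  intro e
  refine IsOpen.union (IsOpen.and ?_ isOpen_const) (IsOpen.and ?_ isOpen_const)
  · exact isOpen_lt (by fun_prop) (by fun_prop)
  · exact isOpen_lt (by fun_prop) (by fun_prop)

theorem isOpen_edgeSheet (e₀ : G.E) (g : FreeGroup G.E) : IsOpen (G.edgeSheet e₀ g) := by
  rw [isOpen_realization_iff]
  intro e
  refine IsOpen.and (IsOpen.and ?_ ?_) isOpen_const
  · exact isOpen_lt (by fun_prop) (by fun_prop)
  · exact isOpen_lt (by fun_prop) (by fun_prop)

/-- The sheet of a point near a vertex is determined by the point, and `h` translates it by left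
multiplication, which is free. -/
theorem eq_one_of_mem_vertexSheet {g h : FreeGroup G.E} {x : G.cover.Realization}
    (hx : x ∈ G.vertexSheet g) (hh : h • x ∈ G.vertexSheet g) : h = 1 := by
  obtain ⟨⟨v, k⟩ | ⟨⟨e, k⟩, t⟩⟩ := x
  · have h1 : k = g := hx
    have h2 : h * k = g := hh
    rw [← h1] at h2
    exact mul_eq_right.1 h2
  · have hh' : G.cover.charMap (e, h * k) t ∈ G.vertexSheet g := hh
    rcases charMap_mem_vertexSheet.1 hx with ⟨ht, h1⟩ | ⟨ht, h1⟩ <;>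
      rcases charMap_mem_vertexSheet.1 hh' with ⟨ht', h2⟩ | ⟨ht', h2⟩
    · rw [← h1] at h2; exact mul_eq_right.1 h2
    · linarith
    · linarith
    · rw [← h1, mul_assoc] at h2; exact mul_eq_right.1 h2

theorem eq_one_of_mem_edgeSheet {e₀ : G.E} {g h : FreeGroup G.E} {x : G.cover.Realization}
    (hx : x ∈ G.edgeSheet e₀ g) (hh : h • x ∈ G.edgeSheet e₀ g) : h = 1 := by
  obtain ⟨⟨v, k⟩ | ⟨⟨e, k⟩, t⟩⟩ := x
  · exact hx.elim
  · have hh' : G.cover.charMap (e, h * k) t ∈ G.edgeSheet e₀ g := hh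
    obtain ⟨-, ⟨he, h1⟩ | ⟨he, h1⟩⟩ := charMap_mem_edgeSheet.1 hx <;>
      obtain ⟨-, ⟨he', h2⟩ | ⟨he', h2⟩⟩ := charMap_mem_edgeSheet.1 hh'
    · rw [← h1] at h2; exact mul_eq_right.1 h2
    · exact absurd (he'.trans he.symm) (G.rev_ne e)
    · exact absurd (he.trans he'.symm) (G.rev_ne e)
    · rw [← h1, mul_assoc] at h2; exact mul_eq_right.1 h2

/-- Sheets around vertices and around open edges are disjoint from their nontrivial translates. The
fibres are orbits because each elementary gluing downstairs lifts to one upstairs. The covering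
space need not be connected; only its monodromy is needed. -/
theorem isQuotientCoveringMap_cover :
    IsQuotientCoveringMap G.coverHom.realize (FreeGroup G.E) where
  surjective := by
    rintro ⟨v | ⟨e, t⟩⟩
    · exact ⟨G.cover.vertexPt (v, 1), rfl⟩
    · exact ⟨G.cover.charMap (e, 1) t, rfl⟩
  eq_coinduced := by
    ext U
    rw [isOpen_coinduced]
    refine ⟨fun h => h.preimage G.coverHom.continuous_realize, fun h => ?_⟩
    rw [isOpen_realization_iff] at h ⊢
    exact fun e => h (e, 1)
  continuous_const_smul h := (G.coverSMul h).continuous_realize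
  apply_eq_iff_mem_orbit := by
    intro x y
    constructor
    · intro h
      -- Representatives over the same representative are translates of each other; induction along
      -- a chain of gluings extends this to representatives over equivalent ones.
      have key : ∀ r r' : G.V ⊕ (G.E × I), Relation.EqvGen G.Glue r r' →
          ∀ x y : G.cover.V ⊕ (G.cover.E × I),
          Sum.map (fun v : G.cover.V => v.1) (fun p : G.cover.E × I => (p.1.1, p.2)) x = r →
          Sum.map (fun v : G.cover.V => v.1) (fun p : G.cover.E × I => (p.1.1, p.2)) y = r' →
          ∃ h : FreeGroup G.E, h • G.cover.repPt y = G.cover.repPt x := by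
        have hself : ∀ (r : G.V ⊕ (G.E × I)) (x y : G.cover.V ⊕ (G.cover.E × I)),
          Sum.map (fun v : G.cover.V => v.1) (fun p : G.cover.E × I => (p.1.1, p.2)) x = r →
          Sum.map (fun v : G.cover.V => v.1) (fun p : G.cover.E × I => (p.1.1, p.2)) y = r →
          ∃ h : FreeGroup G.E, h • G.cover.repPt y = G.cover.repPt x := by
          rintro r (⟨v, g⟩ | ⟨⟨e, g⟩, t⟩) (⟨v', g'⟩ | ⟨⟨e', g'⟩, t'⟩) rfl hy
          · obtain rfl : v' = v := Sum.inl.inj hy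
            refine ⟨g * g'⁻¹, ?_⟩
            show G.cover.vertexPt (v', g * g'⁻¹ * g') = G.cover.vertexPt (v', g)
            rw [inv_mul_cancel_right]
          · cases hy
          · cases hy
          · have hy' := Sum.inr.inj hy
            obtain rfl : e' = e := congrArg Prod.fst hy'
            obtain rfl : t' = t := congrArg Prod.snd hy'
            refine ⟨g * g'⁻¹, ?_⟩
            show G.cover.charMap (e', g * g'⁻¹ * g') t' = G.cover.charMap (e', g) t'
            rw [inv_mul_cancel_right]
        intro r r' h
        induction h with
        | rel r r' h =>
          intro x y hx hy
          cases h with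
          | start e =>
            obtain ⟨h, hh⟩ := hself _ x (Sum.inr ((e, 1), 0)) hx rfl
            obtain ⟨h', hh'⟩ := hself _ (Sum.inl (G.src e, 1)) y rfl hy
            refine ⟨h * h', ?_⟩
            rw [mul_smul, hh', ← hh]
            exact congrArg (h • ·) (Quot.sound (Glue.start (G := G.cover) (e, 1))).symm
          | flip e t =>
            obtain ⟨h, hh⟩ := hself _ x (Sum.inr ((e, 1), t)) hx rfl
            obtain ⟨h', hh'⟩ := hself _ (Sum.inr (G.cover.rev (e, 1), unitInterval.symm t)) y rfl hy
            refine ⟨h * h', ?_⟩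
            rw [mul_smul, hh', ← hh]
            exact congrArg (h • ·) (Quot.sound (Glue.flip (G := G.cover) (e, 1) t)).symm
        | refl r => exact hself r
        | symm r r' _ ih =>
          intro x y hx hy
          obtain ⟨h, hh⟩ := ih y x hy hx
          exact ⟨h⁻¹, by rw [← hh, inv_smul_smul]⟩
        | trans r r' r'' _ _ ih₁ ih₂ =>
          intro x y hx hy
          obtain ⟨z, hz⟩ : ∃ z : G.cover.V ⊕ (G.cover.E × I),
              Sum.map (fun v : G.cover.V => v.1) (fun p : G.cover.E × I => (p.1.1, p.2)) z = r' := by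
            rcases r' with v | ⟨e, t⟩
            · exact ⟨Sum.inl (v, 1), rfl⟩
            · exact ⟨Sum.inr ((e, 1), t), rfl⟩
          obtain ⟨h, hh⟩ := ih₁ x z hx hz
          obtain ⟨h', hh'⟩ := ih₂ z y hz hy
          exact ⟨h * h', by rw [mul_smul, hh', hh]⟩
      obtain ⟨x⟩ := x
      obtain ⟨y⟩ := y
      obtain ⟨k, hk⟩ := key _ _ (Quot.eqvGen_exact h) x y rfl rfl
      exact ⟨k, hk⟩
    · rintro ⟨h, rfl⟩
      obtain ⟨⟨v, g⟩ | ⟨⟨e, g⟩, t⟩⟩ := y <;> rfl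
  disjoint := by
    have hV : ∀ (g : FreeGroup G.E) (x : G.cover.Realization), x ∈ G.vertexSheet g →
        ∃ U ∈ nhds x, ∀ h : FreeGroup G.E, ((h • ·) '' U ∩ U).Nonempty → h = 1 := by
      intro g x hx
      refine ⟨_, (isOpen_vertexSheet g).mem_nhds hx, ?_⟩
      rintro h ⟨_, ⟨y, hy, rfl⟩, hy'⟩
      exact eq_one_of_mem_vertexSheet hy hy'
    rintro ⟨⟨v, g⟩ | ⟨⟨e, g⟩, t⟩⟩
    · exact hV g _ rfl
    · by_cases ht : 0 < (t : ℝ) ∧ (t : ℝ) < 1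
      · refine ⟨_, (isOpen_edgeSheet e g).mem_nhds ⟨ht, Or.inl ⟨rfl, rfl⟩⟩, ?_⟩
        rintro h ⟨_, ⟨y, hy, rfl⟩, hy'⟩
        exact eq_one_of_mem_edgeSheet hy hy'
      · rcases lt_or_ge (t : ℝ) (1 / 2) with h | h
        · exact hV g _ (Or.inl ⟨h, rfl⟩)
        · refine hV (g * G.edgeClass e) _ (Or.inr ⟨?_, rfl⟩)
          have : ¬ (t : ℝ) < 1 := fun h1 => ht ⟨by linarith, h1⟩
          linarith

/-- The lift of an edge path to the covering graph. -/
theorem exists_lift_cover {u w : G.V} {q : Homotopic.Quotient (G.vertexPt u) (G.vertexPt w)}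
    {l : List G.E} (h : IsEdgeClass q l) (g : FreeGroup G.E) :
    ∃ Q : Homotopic.Quotient (G.cover.vertexPt (u, g)) (G.cover.vertexPt (w, g * G.pathClass l)),
      Q.map ⟨G.coverHom.realize, G.coverHom.continuous_realize⟩ = q := by
  induction l generalizing u g with
  | nil =>
    obtain ⟨h0, h1⟩ := h
    cases h0
    rw [h1, pathClass_nil, mul_one]
    exact ⟨Homotopic.Quotient.refl _, rfl⟩
  | cons e l ih =>
    obtain rfl := h.isEdgePath.1
    obtain ⟨q', hq', rfl⟩ := isEdgeClass_cons_iff.1 h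
    obtain ⟨Q, hQ⟩ := ih hq' (g * G.edgeClass e)
    rw [pathClass_cons, ← mul_assoc]
    refine ⟨(Homotopic.Quotient.mk (G.cover.edgePath (e, g))).trans Q, ?_⟩
    subst hQ
    obtain ⟨p⟩ := Q
    exact congrArg Homotopic.Quotient.mk (Path.map_trans (G.cover.edgePath (e, g)) p
      G.coverHom.continuous_realize)

/-- Homotopic edge paths have the same class. -/
theorem IsEdgeClass.pathClass_eq {u w : G.V}
    {q : Homotopic.Quotient (G.vertexPt u) (G.vertexPt w)} {l l' : List G.E}
    (h : IsEdgeClass q l) (h' : IsEdgeClass q l') : G.pathClass l = G.pathClass l' := by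
  obtain ⟨Q, hQ⟩ := exists_lift_cover h 1
  obtain ⟨Q', hQ'⟩ := exists_lift_cover h' 1
  have cov := (isQuotientCoveringMap_cover (G := G)).isCoveringMap
  -- Both lifts start on the sheet of `1` and cover the same homotopy class, so monodromy gives them
  -- the same endpoint, whose sheet is the class of the path.
  have h1 := (cov.monodromy_map Q).symm.trans ((congrArg (fun q => cov.monodromy q _)
    (hQ.trans hQ'.symm)).trans (cov.monodromy_map Q'))
  have h2 : G.cover.vertexPt (w, 1 * G.pathClass l) = G.cover.vertexPt (w, 1 * G.pathClass l') :=
    congrArg Subtype.val h1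
  -- Membership in a vertex sheet reads the group coordinate off a point of the quotient.
  have h3 : 1 * G.pathClass l' = 1 * G.pathClass l :=
    Eq.mp (congrArg (· ∈ G.vertexSheet (1 * G.pathClass l)) h2) rfl
  simpa using h3.symm

end Cover

end SerreGraph

namespace SerreGraph

/-! ### The class of a path between vertices -/

section Holonomy

variable {G : SerreGraph}

open Path

/-- The class of the edge paths in a homotopy class of paths between vertices. -/
noncomputable def homotopyClass {u w : G.V} (q : Homotopic.Quotient (G.vertexPt u) (G.vertexPt w)) :
    FreeGroup G.E :=
  G.pathClass (exists_isEdgeClass q).choose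

theorem IsEdgeClass.homotopyClass_eq {u w : G.V}
    {q : Homotopic.Quotient (G.vertexPt u) (G.vertexPt w)} {l : List G.E} (h : IsEdgeClass q l) :
    homotopyClass q = G.pathClass l :=
  (exists_isEdgeClass q).choose_spec.pathClass_eq h

theorem homotopyClass_trans {u v w : G.V} (q : Homotopic.Quotient (G.vertexPt u) (G.vertexPt v))
    (q' : Homotopic.Quotient (G.vertexPt v) (G.vertexPt w)) :
    homotopyClass (q.trans q') = homotopyClass q * homotopyClass q' := by
  obtain ⟨l, hl⟩ := exists_isEdgeClass q
  obtain ⟨l', hl'⟩ := exists_isEdgeClass q'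
  rw [(hl.trans hl').homotopyClass_eq, hl.homotopyClass_eq, hl'.homotopyClass_eq, pathClass_append]

theorem homotopyClass_symm {u w : G.V} (q : Homotopic.Quotient (G.vertexPt u) (G.vertexPt w)) :
    homotopyClass q.symm = (homotopyClass q)⁻¹ := by
  obtain ⟨l, hl⟩ := exists_isEdgeClass q
  rw [hl.symm.homotopyClass_eq, hl.homotopyClass_eq, pathClass_reversePath]

theorem homotopyClass_injective {u w : G.V} : Function.Injective
    (homotopyClass : Homotopic.Quotient (G.vertexPt u) (G.vertexPt w) → FreeGroup G.E) := by
  intro q q' h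
  obtain ⟨l, hl⟩ := exists_isEdgeClass q
  obtain ⟨l', hl'⟩ := exists_isEdgeClass q'
  rw [hl.homotopyClass_eq, hl'.homotopyClass_eq] at h
  exact hl.congr hl' h

end Holonomy

/-! ### The fundamental group of the rose -/

section Rose

variable {n : ℕ}

open Path

/-- The homotopy class of the loop in the rose that represents an element of the free group. -/
noncomputable def wordClass (g : FreeGroup (Fin n)) :
    Homotopic.Quotient ((rose n).vertexPt ()) ((rose n).vertexPt ()) :=
  Homotopic.Quotient.mk (wordLoop g)

theorem isEdgeClass_wordClass (g : FreeGroup (Fin n)) :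
    IsEdgeClass (G := rose n) (u := ()) (w := ()) (wordClass g) g.toWord :=
  isEdgeClass_realizePath (rose_isEdgePath n g.toWord)

variable (n) in
/-- The map on the free group that is given by the classes of the edges of the rose. -/
def roseHom : FreeGroup (Fin n) →* FreeGroup (rose n).E :=
  FreeGroup.lift fun i => (rose n).edgeClass (i, true)

theorem pathClass_rose (l : List (Fin n × Bool)) :
    (rose n).pathClass l = roseHom n (FreeGroup.mk l) := by
  rw [roseHom, FreeGroup.lift_mk]
  refine congrArg List.prod (List.map_congr_left ?_)
  rintro ⟨i, _ | _⟩ -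
  · exact edgeClass_rev (G := rose n) (i, true)
  · rfl

theorem homotopyClass_wordClass (g : FreeGroup (Fin n)) :
    homotopyClass (G := rose n) (u := ()) (w := ()) (wordClass g) = roseHom n g := by
  rw [(isEdgeClass_wordClass g).homotopyClass_eq, pathClass_rose, FreeGroup.mk_toWord]

/-- The reduced word of a product is not the concatenation of the reduced words, so the comparison
is made in the free group on the edges, where `homotopyClass` is faithful. -/
theorem wordClass_mul (g h : FreeGroup (Fin n)) :
    wordClass (g * h) = (wordClass g).trans (wordClass h) := by
  apply homotopyClass_injective (G := rose n) (u := ()) (w := ())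
  rw [homotopyClass_trans (G := rose n) (u := ()) (v := ()) (w := ()), homotopyClass_wordClass,
    homotopyClass_wordClass, homotopyClass_wordClass, map_mul]

theorem isReducedPath_toWord (g : FreeGroup (Fin n)) : (rose n).IsReducedPath g.toWord := by
  refine List.IsChain.imp ?_ (FreeGroup.isReduced_toWord (x := g))
  rintro ⟨i, a⟩ ⟨j, b⟩ h hr
  obtain ⟨rfl, rfl⟩ := Prod.mk.inj hr
  exact absurd (h rfl) (by cases a <;> simp)

theorem wordClass_injective : Function.Injective (wordClass (n := n)) := by
  intro g h hgh
  have hc := IsEdgeClass.pathClass_eq (isEdgeClass_wordClass g)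
    (show IsEdgeClass (G := rose n) (u := ()) (w := ()) (wordClass g) h.toWord by
      rw [hgh]; exact isEdgeClass_wordClass h)
  exact FreeGroup.toWord_injective
    ((isReducedPath_toWord g).eq_of_pathClass_eq (isReducedPath_toWord h) hc)

theorem wordClass_surjective : Function.Surjective (wordClass (n := n)) := by
  intro q
  obtain ⟨l, hl⟩ := exists_isEdgeClass (G := rose n) (u := ()) (w := ()) q
  refine ⟨FreeGroup.mk l, homotopyClass_injective (G := rose n) (u := ()) (w := ()) ?_⟩
  rw [homotopyClass_wordClass, hl.homotopyClass_eq]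
  exact (pathClass_rose l).symm

end Rose

/-! ### The homomorphism induced by a marking -/

section Marking

open Path

theorem _root_.ContinuousMap.HomotopyEquiv.bijective_map {X Y : Type*} [TopologicalSpace X]
    [TopologicalSpace Y] (f : X ≃ₕ Y) (x y : X) : Function.Bijective
      fun q : Homotopic.Quotient x y => q.map f.toFun := by
  let F := FundamentalGroupoidFunctor.equivOfHomotopyEquiv f
  have h1 := F.faithful_functor.map_injective (X := (⟨x⟩ : FundamentalGroupoid X)) (Y := ⟨y⟩)
  have h2 := F.full_functor.map_surjective (X := (⟨x⟩ : FundamentalGroupoid X)) (Y := ⟨y⟩)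
  exact ⟨h1, h2⟩

theorem _root_.Path.Homotopic.Quotient.map_trans {X Y : Type*} [TopologicalSpace X]
    [TopologicalSpace Y] (f : C(X, Y)) {x y z : X} (q : Homotopic.Quotient x y)
    (q' : Homotopic.Quotient y z) : (q.trans q').map f = (q.map f).trans (q'.map f) := by
  obtain ⟨p⟩ := q
  obtain ⟨p'⟩ := q'
  exact congrArg Homotopic.Quotient.mk (Path.map_trans p p' f.continuous)

/-- A free homotopy of loops is a homotopy between conjugate loops. -/
theorem _root_.FreelyHomotopic.exists_trans_eq {X : Type*} [TopologicalSpace X] {x y : X}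
    {p : Path x x} {q : Path y y} (h : FreelyHomotopic p q) : ∃ r : Homotopic.Quotient x y,
      (Homotopic.Quotient.mk p).trans r = r.trans (Homotopic.Quotient.mk q) := by
  obtain ⟨K, h0, h1, hK⟩ := h
  let r : Path x y :=
    { toFun := fun t => K (t, 0)
      continuous_toFun := by fun_prop
      source' := (h0 0).trans p.source
      target' := (h1 0).trans q.source }
  exact ⟨Homotopic.Quotient.mk r, Homotopic.Quotient.eq.2
    (Path.Homotopic.of_square K p r r q (fun t => (h0 t).symm) hK (fun _ => rfl)
      fun t => (h1 t).symm)⟩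

/-- The image of the base point need not be a vertex, so it is joined to a vertex `o` by a straight
path `δ`, and `θ g` is the class of the image loop of `g` conjugated by `δ`. A free homotopy to a
circuit drags the base point along a path `r`, and `p` is an edge path homotopic to `δ` followed by
`r`. -/
theorem exists_markingHom {n : ℕ} {G : SerreGraph} (f : (rose n).Realization ≃ₕ G.Realization) :
    ∃ (o : G.V) (θ : FreeGroup (Fin n) →* FreeGroup G.E), Function.Injective θ ∧
      (∀ l, G.IsEdgePath o l o → ∃ g, θ g = G.pathClass l) ∧
      (∀ g, ∃ l, G.IsEdgePath o l o ∧ θ g = G.pathClass l) ∧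
      ∀ (c : G.Circuit) (g : FreeGroup (Fin n)),
        FreelyHomotopic ((wordLoop g).map f.toFun.continuous) c.loop → ∃ p,
          G.IsEdgePath o p c.base ∧
          θ g = G.pathClass p * G.pathClass c.edges * (G.pathClass p)⁻¹ := by
  obtain ⟨o, ⟨δ⟩⟩ : ∃ o : G.V, Nonempty
      (Homotopic.Quotient (G.vertexPt o) (f.toFun ((rose n).vertexPt ()))) := by
    obtain ⟨r, hr⟩ := Quot.exists_rep (f.toFun ((rose n).vertexPt ()))
    rw [← hr]
    exact ⟨_, ⟨Homotopic.Quotient.mk (G.straightPath r)⟩⟩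
  let Q : FreeGroup (Fin n) → Homotopic.Quotient (G.vertexPt o) (G.vertexPt o) := fun g =>
    (δ.trans ((wordClass g).map f.toFun)).trans δ.symm
  have hQ : ∀ g h, Q (g * h) = (Q g).trans (Q h) := fun g h => by
    simp only [Q, wordClass_mul, Homotopic.Quotient.map_trans, Homotopic.Quotient.trans_assoc]
    rw [← Homotopic.Quotient.trans_assoc δ.symm, Homotopic.Quotient.symm_trans,
      Homotopic.Quotient.refl_trans]
  let θ : FreeGroup (Fin n) →* FreeGroup G.E :=
    MonoidHom.mk' (fun g => homotopyClass (Q g)) fun g h => by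
      rw [hQ, homotopyClass_trans]
  have hθ : ∀ g, θ g = homotopyClass (Q g) := fun _ => rfl
  have hconj : ∀ q : Homotopic.Quotient (f.toFun ((rose n).vertexPt ()))
      (f.toFun ((rose n).vertexPt ())),
      -- Conjugation by `δ` can be undone, so it loses no information about `q`.
      (δ.symm.trans ((δ.trans q).trans δ.symm)).trans δ = q := fun q => by
    simp only [Homotopic.Quotient.trans_assoc, Homotopic.Quotient.symm_trans,
      Homotopic.Quotient.trans_refl]
    rw [← Homotopic.Quotient.trans_assoc, Homotopic.Quotient.symm_trans,
      Homotopic.Quotient.refl_trans]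
  refine ⟨o, θ, fun g h hgh => ?_, fun l hl => ?_, fun g => ?_, fun c g hg => ?_⟩
  · have h1 : Q g = Q h := homotopyClass_injective hgh
    have h2 := congrArg (fun q => (δ.symm.trans q).trans δ) h1
    simp only [Q, hconj] at h2
    exact wordClass_injective ((f.bijective_map _ _).1 h2)
  · obtain ⟨q, hq⟩ := (f.bijective_map _ _).2
      ((δ.symm.trans (Homotopic.Quotient.mk (G.realizePath o l o hl))).trans δ)
    obtain ⟨g, rfl⟩ := wordClass_surjective q
    refine ⟨g, ?_⟩
    rw [hθ, ← (isEdgeClass_realizePath hl).homotopyClass_eq]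
    congr 1
    have hq' : (wordClass g).map f.toFun = _ := hq
    simp only [Q, hq', Homotopic.Quotient.trans_assoc, Homotopic.Quotient.trans_symm,
      Homotopic.Quotient.trans_refl]
    rw [← Homotopic.Quotient.trans_assoc, Homotopic.Quotient.trans_symm,
      Homotopic.Quotient.refl_trans]
  · obtain ⟨l, hl⟩ := exists_isEdgeClass (Q g)
    exact ⟨l, hl.isEdgePath, hl.homotopyClass_eq⟩
  · obtain ⟨r, hr⟩ := hg.exists_trans_eq
    obtain ⟨p, hp⟩ := exists_isEdgeClass (δ.trans r)
    refine ⟨p, hp.isEdgePath, ?_⟩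
    have hc : IsEdgeClass (Homotopic.Quotient.mk c.loop) c.edges := isEdgeClass_realizePath c.closed
    rw [hθ, ← hp.homotopyClass_eq, ← hc.homotopyClass_eq, ← homotopyClass_symm,
      ← homotopyClass_trans, ← homotopyClass_trans]
    congr 1
    have hr' : ((wordClass g).map f.toFun).trans r =
      r.trans (Homotopic.Quotient.mk c.loop) := hr
    have hs : (δ.trans r).trans (δ.trans r).symm = Homotopic.Quotient.refl _ :=
      Homotopic.Quotient.trans_symm _
    rw [Homotopic.Quotient.trans_assoc δ r, ← hr', ← Homotopic.Quotient.trans_assoc δ]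
    have h4 : r.trans (δ.trans r).symm = δ.symm := by
      have h5 := congrArg (fun q => δ.symm.trans q) hs
      simp only [Homotopic.Quotient.trans_refl] at h5
      rw [← h5, ← Homotopic.Quotient.trans_assoc, ← Homotopic.Quotient.trans_assoc,
        Homotopic.Quotient.symm_trans, Homotopic.Quotient.refl_trans]
    simp only [Q]
    rw [← h4]
    simp only [Homotopic.Quotient.trans_assoc]

end Marking

end SerreGraph

/-! ### The cut vertex test for marked graphs -/

theorem FreeGroupBasis.finite {n : ℕ} {κ : Type*} (b : FreeGroupBasis κ (FreeGroup (Fin n))) :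
    Finite κ :=
  Finite.of_equiv _ (Equiv.ofFreeGroupEquiv b.repr)

open SerreGraph in
theorem mainTheorem6 {n : ℕ} (H : MarkedGraph n) {k : ℕ} (γ : Fin k → H.graph.Circuit)
    (hγ : H.RepresentsPartialFreeBasis γ) :
    NearVisibility γ ∨ CutVertexCondition γ := by
  obtain ⟨g, ⟨hg, κ, b, hgb⟩, hrep⟩ := hγ
  obtain ⟨o, θ, hinj, hsurj, hloop, hconj⟩ := exists_markingHom H.marking
  have : Finite κ := b.finite
  choose idx hidx using fun i => hgb ⟨i, rfl⟩
  -- Distinctness of the `g i` guarantees that each basis element is assigned at most one circuit,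
  -- so the circle of its lollipop is well defined.
  have hidx_inj : Function.Injective idx := fun i j h => hg (by rw [← hidx, ← hidx, h])
  have hθ1 : ∀ j, θ (b j) ≠ 1 := fun j h => by
    have h1 : b j = 1 := hinj (h.trans (map_one θ).symm)
    have h2 := congrArg b.repr h1
    rw [b.repr_apply_coe, map_one] at h2
    exact FreeGroup.of_ne_one j h2
  have key : ∀ j, ∃ (v : H.graph.V) (p c : List H.graph.E), H.graph.IsEdgePath o p v ∧
      H.graph.IsEdgePath v c v ∧ p ≠ [] ∧ c ≠ [] ∧
      θ (b j) = H.graph.pathClass p * H.graph.pathClass c * (H.graph.pathClass p)⁻¹ ∧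
      ∀ i, idx i = j → c = (γ i).edges := by
    intro j
    obtain ⟨l, hl, hlj⟩ := hloop (b j)
    obtain ⟨e, l, rfl⟩ := List.exists_cons_of_ne_nil (l := l) (fun h => hθ1 j (by rw [hlj, h]; rfl))
    obtain ⟨v, p, c, hp, hc, hc0, h, hi⟩ : ∃ (v : H.graph.V) (p c : List H.graph.E),
        H.graph.IsEdgePath o p v ∧ H.graph.IsEdgePath v c v ∧ c ≠ [] ∧
        θ (b j) = H.graph.pathClass p * H.graph.pathClass c * (H.graph.pathClass p)⁻¹ ∧
        ∀ i, idx i = j → c = (γ i).edges := by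
      by_cases hj : ∃ i, idx i = j
      · obtain ⟨i, rfl⟩ := hj
        obtain ⟨p, hp, h⟩ := hconj (γ i) (g i) (hrep i)
        exact ⟨_, p, _, hp, (γ i).closed, (γ i).edges_ne_nil, by rw [hidx, h],
          fun i' h => by rw [hidx_inj h]⟩
      -- A basis element outside the partial basis is represented by any loop at `o` of its class,
      -- with a trivial stem.
      · exact ⟨o, [], _, rfl, hl, List.cons_ne_nil e l, by rw [hlj]; simp,
          fun i h => absurd ⟨i, h⟩ hj⟩
    -- Arcs of the subdivision must have positive length. The backtrack along `e`, the first edge of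
    -- a loop for the nontrivial element `θ (b j)`, makes the stem nonempty without changing its
    -- class.
    refine ⟨v, e :: H.graph.rev e :: p, c, ⟨hl.1, rfl, ?_⟩, hc, List.cons_ne_nil _ _, hc0, ?_, hi⟩
    · rw [tgt_rev, hl.1]; exact hp
    · rw [h]; simp [edgeClass_rev]
  choose v p c hp hc hp0 hc0 hθ hi using key
  have hfam : (fun i => c (idx i)) = fun i => (γ i).edges := funext fun i => hi _ i rfl
  have := turnGraph_good_of_basis b θ hinj hsurj v p c hp hc hp0 hc0 hθ idx
    (by rw [hfam]; exact isReducedFamily_edges γ)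
  rw [hfam] at this
  exact this.imp nearVisibility_of_hasDisjointEdges cutVertexCondition_of_hasCutVertex
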